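/- **Setting.** $\mathsf{HA}$ is intuitionistic first-order arithmetic with equality, in the language with logical constants $\forall,\exists,\to,\land,\lor,\bot$ (where $\neg\varphi$ is $\varphi\to\bot$) and a function symbol for every primitive recursive function; its axioms are the successor axioms, the defining equations of the primitive recursive functions, and induction for all formulas. $\mathsf{PA}$ is $\mathsf{HA}$ plus the law of excluded middle for all formulas. Formulas may contain free variables, and $\mathrm{FV}(\varphi)$ is the set of free variables of $\varphi$. A theory is given by a set of axioms in this language, with intuitionistic logic; it proves a schema if it proves every instance of it. A theory $T$ is in between $T_1$ and $T_2$ if $T$ proves every theorem of $T_1$ and $T_2$ proves every theorem of $T$. **Prenex classes.** $\Sigma_0=\Pi_0$ is the class of quantifier-free formulas; $\Sigma_{k+1}$ is the class of formulas $\exists x_1\cdots\exists x_n\,\psi$ with $n\ge 1$ and $\psi\in\Pi_k$; $\Pi_{k+1}$ is the class of formulas $\forall x_1\cdots\forall x_n\,\psi$ with $n\ge 1$ and $\psi\in\Sigma_k$. **Alternation paths.** To each formula $\varphi$ assign a finite set $\mathrm{Alt}(\varphi)$ of alternating finite sequences of $+$ and $-$. If $\varphi$ is quantifier-free, $\mathrm{Alt}(\varphi)=\{\langle\,\rangle\}$.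 Otherwise, writing $s^\perp$ for $s$ with $+$ and $-$ switched: - $\mathrm{Alt}(\neg\varphi_1)=\{s^\perp: s\in\mathrm{Alt}(\varphi_1)\}$; - $\mathrm{Alt}(\varphi_1\land\varphi_2)=\mathrm{Alt}(\varphi_1\lor\varphi_2)=\mathrm{Alt}(\varphi_1)\cup\mathrm{Alt}(\varphi_2)$; - $\mathrm{Alt}(\varphi_1\to\varphi_2)=\{s^\perp:s\in\mathrm{Alt}(\varphi_1)\}\cup\mathrm{Alt}(\varphi_2)$ if $\varphi_2$ is not $\bot$; - $\mathrm{Alt}(\forall x\,\varphi_1)$ (resp. $\mathrm{Alt}(\exists x\,\varphi_1)$) is obtained from $\mathrm{Alt}(\varphi_1)$ by prefixing $-$ (resp. $+$) to every path that does not already start with that sign. The degree of $\varphi$ is the greatest length of a path in $\mathrm{Alt}(\varphi)$, and $\mathrm F_k$ is the class of formulas of degree $k$. Put $\mathrm U_0=\mathrm E_0=\mathrm F_0$; for $k\ge1$, $\mathrm U_k$ (resp. $\mathrm E_k$) is the class of $\varphi\in\mathrm F_k$ all of whose alternation paths of length $k$ start with $-$ (resp. $+$). Finally $\mathrm U_k^+=\mathrm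 U_k\cup\bigcup_{i<k}\mathrm F_i$. **Principles.** For a class $\Gamma$ of formulas: - $\Gamma\text{-LEM}$: $\forall x(\varphi(x)\lor\neg\varphi(x))$, for $\varphi\in\Gamma$ with $\mathrm{FV}(\varphi)\subseteq\{x\}$; - $\Gamma\text{-DNE}$: $\forall x(\neg\neg\varphi(x)\to\varphi(x))$, for $\varphi\in\Gamma$ with $\mathrm{FV}(\varphi)\subseteq\{x\}$; - $\Gamma\text{-DNS}$: $\forall x(\forall y\,\neg\neg\varphi(x,y)\to\neg\neg\forall y\,\varphi(x,y))$, for $\varphi\in\Gamma$ with $\mathrm{FV}(\varphi)\subseteq\{x,y\}$. **Theorem.** Let $k\ge 0$ and let $T$ be a theory in between $\mathsf{HA}+\Pi_{k-1}\text{-LEM}$ ($\mathsf{HA}$ if $k=0$) and $\mathsf{PA}$. Then $T$ proves both $\Sigma_k\text{-DNE}$ and $\mathrm U_k^+\text{-DNS}$ if and only if, for every $k'\le k$ and every $\varphi\in\mathrm E_{k'}$, there is $\varphi'\in\Sigma_{k'}$ such that $\mathrm{FV}(\varphi)=\mathrm{FV}(\varphi')$ and $T\vdash\varphi\leftrightarrow\varphi'$.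 -/

import Mathlib

namespace HeytingArith

/-! ### The language of arithmetic with a symbol for every primitive recursive function -/

/-- Primitive recursive function symbols of each arity, one for each way of building a
primitive recursive function from zero, successor and projections by composition and
primitive recursion (on the first argument). -/
inductive PRFun : ℕ → Type
  | zero : PRFun 0
  | succ : PRFun 1
  | proj {n : ℕ} (i : Fin n) : PRFun n
  | comp {m n : ℕ} (f : PRFun m) (g : Fin m → PRFun n) : PRFun n
  | prec {n : ℕ} (f : PRFun n) (g : PRFun (n + 2)) : PRFun (n + 1)

/-- The language of arithmetic: all primitive recursive function symbols; equality is the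
only predicate. -/
abbrev LPR : FirstOrder.Language := ⟨PRFun, fun _ => Empty⟩

/-- Terms, with variables numbered by `ℕ`. -/
abbrev Tm : Type := LPR.Term ℕ

/-- The variable number `n`. -/
abbrev Tm.v (n : ℕ) : Tm := FirstOrder.Language.Term.var n

/-- Application of a function symbol. -/
abbrev Tm.app {n : ℕ} (f : PRFun n) (ts : Fin n → Tm) : Tm :=
  FirstOrder.Language.Term.func (L := LPR) f ts

/-- The constant `0`. -/
def Tm.zero : Tm := Tm.app PRFun.zero ![]

/-- The successor of a term. -/
def Tm.succ (t : Tm) : Tm := Tm.app PRFun.succ ![t]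

/-- Formulas, in de Bruijn form: in `all φ` and `ex φ` the variable `0` of `φ` is bound, and
the variable `n + 1` of `φ` is the variable `n` of the whole formula. -/
inductive Form : Type
  | bot : Form
  | eq (s t : Tm) : Form
  | and (φ ψ : Form) : Form
  | or (φ ψ : Form) : Form
  | imp (φ ψ : Form) : Form
  | all (φ : Form) : Form
  | ex (φ : Form) : Form

namespace Form

/-- Negation `φ → ⊥`. -/
def neg (φ : Form) : Form := imp φ bot

/-- Equivalence of two formulas, as a formula. -/
def iff (φ ψ : Form) : Form := and (imp φ ψ) (imp ψ φ)

/-- The set of free variables. -/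
def fv : Form → Set ℕ
  | bot => ∅
  | eq s t => (s.varFinset : Set ℕ) ∪ (t.varFinset : Set ℕ)
  | and φ ψ => φ.fv ∪ ψ.fv
  | or φ ψ => φ.fv ∪ ψ.fv
  | imp φ ψ => φ.fv ∪ ψ.fv
  | all φ => {n | n + 1 ∈ φ.fv}
  | ex φ => {n | n + 1 ∈ φ.fv}

/-- A substitution pushed under a quantifier. -/
def up (σ : ℕ → Tm) : ℕ → Tm
  | 0 => Tm.v 0
  | n + 1 => (σ n).relabel Nat.succ

/-- Simultaneous capture-avoiding substitution of terms for the free variables. -/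
def subst : Form → (ℕ → Tm) → Form
  | bot, _ => bot
  | eq s t, σ => eq (s.subst σ) (t.subst σ)
  | and φ ψ, σ => and (φ.subst σ) (ψ.subst σ)
  | or φ ψ, σ => or (φ.subst σ) (ψ.subst σ)
  | imp φ ψ, σ => imp (φ.subst σ) (ψ.subst σ)
  | all φ, σ => all (φ.subst (up σ))
  | ex φ, σ => ex (φ.subst (up σ))

/-- Renaming of every free variable `n` to `n + 1`, so that the variable `0` becomes fresh. -/
def shift (φ : Form) : Form := φ.subst (fun n => Tm.v (n + 1))

/-- The term `t` for the variable `0`, the variable `n` for `n + 1`. -/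
def single (t : Tm) : ℕ → Tm
  | 0 => t
  | n + 1 => Tm.v n

/-- `φ(t)`, for the body `φ` of a quantified formula. -/
def inst (φ : Form) (t : Tm) : Form := φ.subst (single t)

/-- The successor of the variable `0` for the variable `0`, the others being unchanged. -/
def stepSubst : ℕ → Tm
  | 0 => Tm.succ (Tm.v 0)
  | n + 1 => Tm.v (n + 1)

/-- Quantifier-free formulas. -/
def isQF : Form → Bool
  | bot => true
  | eq _ _ => true
  | and φ ψ => φ.isQF && ψ.isQF
  | or φ ψ => φ.isQF && ψ.isQF
  | imp φ ψ => φ.isQF && ψ.isQF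
  | all _ => false
  | ex _ => false

/-- Is the formula `⊥`? -/
def isBot : Form → Bool
  | bot => true
  | _ => false

end Form

/-! ### Intuitionistic derivability -/

/-- Intuitionistic natural deduction with equality: `Deriv T Γ φ` says that `φ` is derivable
from the assumptions `Γ` in the theory with nonlogical axioms `T`. Free variables of an axiom
of `T` are read as universally quantified, those of `Γ` and `φ` as parameters. -/
inductive Deriv (T : Set Form) : List Form → Form → Prop
  | ax {Γ : List Form} {φ : Form} : φ ∈ T → Deriv T Γ φ
  | hyp {Γ : List Form} {φ : Form} : φ ∈ Γ → Deriv T Γ φ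
  | botE {Γ : List Form} {φ : Form} : Deriv T Γ .bot → Deriv T Γ φ
  | andI {Γ : List Form} {φ ψ : Form} : Deriv T Γ φ → Deriv T Γ ψ → Deriv T Γ (.and φ ψ)
  | andE₁ {Γ : List Form} {φ ψ : Form} : Deriv T Γ (.and φ ψ) → Deriv T Γ φ
  | andE₂ {Γ : List Form} {φ ψ : Form} : Deriv T Γ (.and φ ψ) → Deriv T Γ ψ
  | orI₁ {Γ : List Form} {φ ψ : Form} : Deriv T Γ φ → Deriv T Γ (.or φ ψ)
  | orI₂ {Γ : List Form} {φ ψ : Form} : Deriv T Γ ψ → Deriv T Γ (.or φ ψ)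
  | orE {Γ : List Form} {φ ψ χ : Form} :
      Deriv T Γ (.or φ ψ) → Deriv T (φ :: Γ) χ → Deriv T (ψ :: Γ) χ → Deriv T Γ χ
  | impI {Γ : List Form} {φ ψ : Form} : Deriv T (φ :: Γ) ψ → Deriv T Γ (.imp φ ψ)
  | impE {Γ : List Form} {φ ψ : Form} : Deriv T Γ (.imp φ ψ) → Deriv T Γ φ → Deriv T Γ ψ
  | allI {Γ : List Form} {φ : Form} : Deriv T (Γ.map Form.shift) φ → Deriv T Γ (.all φ)
  | allE {Γ : List Form} {φ : Form} (t : Tm) : Deriv T Γ (.all φ) → Deriv T Γ (φ.inst t)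
  | exI {Γ : List Form} {φ : Form} (t : Tm) : Deriv T Γ (φ.inst t) → Deriv T Γ (.ex φ)
  | exE {Γ : List Form} {φ ψ : Form} :
      Deriv T Γ (.ex φ) → Deriv T (φ :: Γ.map Form.shift) ψ.shift → Deriv T Γ ψ
  | eqRefl {Γ : List Form} (t : Tm) : Deriv T Γ (.eq t t)
  | eqSubst {Γ : List Form} {s t : Tm} (φ : Form) :
      Deriv T Γ (.eq s t) → Deriv T Γ (φ.inst s) → Deriv T Γ (φ.inst t)

/-- `T ⊢ φ`. -/
def Proves (T : Set Form) (φ : Form) : Prop := Deriv T [] φ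

/-- `T` proves every instance of the schema `P`. -/
def ProvesAll (T P : Set Form) : Prop := ∀ φ ∈ P, Proves T φ

/-- `T₂` is an extension of `T₁` (in the same language). -/
def Extends (T₁ T₂ : Set Form) : Prop := ∀ φ, Proves T₁ φ → Proves T₂ φ

/-! ### Heyting and Peano arithmetic -/

/-- The nonlogical axioms of Heyting arithmetic: the axioms for successor, the defining
equations of the primitive recursive function symbols, and induction for all formulas. -/
inductive HAAxiom : Form → Prop
  | succ_ne_zero (t : Tm) : HAAxiom (Form.neg (.eq t.succ Tm.zero))
  | succ_inj (s t : Tm) : HAAxiom (.imp (.eq s.succ t.succ) (.eq s t))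
  | proj {n : ℕ} (i : Fin n) (ts : Fin n → Tm) :
      HAAxiom (.eq (Tm.app (PRFun.proj i) ts) (ts i))
  | comp {m n : ℕ} (f : PRFun m) (g : Fin m → PRFun n) (ts : Fin n → Tm) :
      HAAxiom (.eq (Tm.app (PRFun.comp f g) ts) (Tm.app f (fun j => Tm.app (g j) ts)))
  | prec_zero {n : ℕ} (f : PRFun n) (g : PRFun (n + 2)) (ts : Fin n → Tm) :
      HAAxiom (.eq (Tm.app (PRFun.prec f g) (Fin.cons Tm.zero ts)) (Tm.app f ts))
  | prec_succ {n : ℕ} (f : PRFun n) (g : PRFun (n + 2)) (t : Tm) (ts : Fin n → Tm) :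
      HAAxiom (.eq (Tm.app (PRFun.prec f g) (Fin.cons t.succ ts))
        (Tm.app g (Fin.cons t (Fin.cons (Tm.app (PRFun.prec f g) (Fin.cons t ts)) ts))))
  | induction (φ : Form) :
      HAAxiom (.imp (φ.inst Tm.zero)
        (.imp (.all (.imp φ (φ.subst Form.stepSubst))) (.all φ)))

/-- Heyting arithmetic. -/
def HA : Set Form := {φ | HAAxiom φ}

/-- Peano arithmetic: Heyting arithmetic with the law of excluded middle for all formulas. -/
def PA : Set Form := HA ∪ {χ | ∃ φ : Form, χ = Form.or φ φ.neg}

/-! ### Logical principles -/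

/-- `Γ`-LEM: `∀x (φ(x) ∨ ¬φ(x))` for `φ` in `Γ` with no free variable but `x`. -/
def LEM (Γ : Set Form) : Set Form :=
  {χ | ∃ φ ∈ Γ, φ.fv ⊆ {0} ∧ χ = Form.all (Form.or φ φ.neg)}

/-- `Γ`-DNE: `∀x (¬¬φ(x) → φ(x))` for `φ` in `Γ` with no free variable but `x`. -/
def DNE (Γ : Set Form) : Set Form :=
  {χ | ∃ φ ∈ Γ, φ.fv ⊆ {0} ∧ χ = Form.all (Form.imp φ.neg.neg φ)}

/-- `Γ`-DNS: `∀x (∀y ¬¬φ(x,y) → ¬¬∀y φ(x,y))` for `φ` in `Γ` with no free variables but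
`x` (number `1`) and `y` (number `0`). -/
def DNS (Γ : Set Form) : Set Form :=
  {χ | ∃ φ ∈ Γ, φ.fv ⊆ {0, 1} ∧
    χ = Form.all (Form.imp (Form.all φ.neg.neg) (Form.all φ).neg.neg)}

/-! ### The prenex classes -/

mutual
/-- `Σ_k`: a nonempty block `∃x₁…∃xₙ` in front of a `Π_{k-1}` formula; `Σ_0` is the class of
quantifier-free formulas. -/
def SigmaC : ℕ → Set Form
  | 0 => {φ | φ.isQF = true}
  | k + 1 => {φ | ∃ n : ℕ, ∃ ψ ∈ PiC k, φ = Form.ex^[n + 1] ψ}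
/-- `Π_k`: a nonempty block `∀x₁…∀xₙ` in front of a `Σ_{k-1}` formula; `Π_0` is the class of
quantifier-free formulas. -/
def PiC : ℕ → Set Form
  | 0 => {φ | φ.isQF = true}
  | k + 1 => {φ | ∃ n : ℕ, ∃ ψ ∈ SigmaC k, φ = Form.all^[n + 1] ψ}
end

/-! ### Alternation paths and the classes `F_k`, `U_k`, `E_k` -/

/-- Switching `+` (`true`) and `-` (`false`) in a path. -/
def flipPath (s : List Bool) : List Bool := s.map (! ·)

/-- Prefixing the sign `b` to a path, unless the path starts with `b`. -/
def pushSign (b : Bool) (s : List Bool) : List Bool :=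
  if s.head? = some b then s else b :: s

/-- The set of alternation paths of a formula; `+` is `true` and `-` is `false`. A formula
`φ → ⊥` is treated as the negation of `φ`. -/
def Form.alt : Form → Finset (List Bool)
  | .bot => {[]}
  | .eq _ _ => {[]}
  | .and φ ψ => if (Form.and φ ψ).isQF then {[]} else φ.alt ∪ ψ.alt
  | .or φ ψ => if (Form.or φ ψ).isQF then {[]} else φ.alt ∪ ψ.alt
  | .imp φ ψ =>
      if (Form.imp φ ψ).isQF then {[]}
      else if ψ.isBot then φ.alt.image flipPath
      else φ.alt.image flipPath ∪ ψ.alt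
  | .all φ => φ.alt.image (pushSign false)
  | .ex φ => φ.alt.image (pushSign true)

/-- The degree of a formula: the greatest length of its alternation paths. -/
def Form.degree (φ : Form) : ℕ := φ.alt.sup List.length

/-- `F_k`: the formulas of degree `k`. -/
def FC (k : ℕ) : Set Form := {φ | φ.degree = k}

/-- `U_k`: the formulas of degree `k` whose alternation paths of length `k` start with `-`
(no condition on the sign if `k = 0`). -/
def UC : ℕ → Set Form
  | 0 => FC 0
  | k + 1 => {φ | φ ∈ FC (k + 1) ∧ ∀ s ∈ φ.alt, s.length = k + 1 → s.head? = some false}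

/-- `E_k`: the formulas of degree `k` whose alternation paths of length `k` start with `+`
(no condition on the sign if `k = 0`). -/
def EC : ℕ → Set Form
  | 0 => FC 0
  | k + 1 => {φ | φ ∈ FC (k + 1) ∧ ∀ s ∈ φ.alt, s.length = k + 1 → s.head? = some true}

/-- `U_k^+`: the formulas that are in `U_k` or of degree less than `k`. -/
def UPlus (k : ℕ) : Set Form := UC k ∪ ⋃ i < k, FC i

/-! ### The theory `HA + Π_{k-1}-LEM` and the prenex normal form property -/

/-- `HA + Π_{k-1}-LEM`, which is `HA` if `k = 0`. -/
def HAPiLEM : ℕ → Set Form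
  | 0 => HA
  | k + 1 => HA ∪ LEM (PiC k)

/-- `PNFT_T(Γ, Γ')`: every formula in `Γ` is equivalent, provably in `T`, to a formula in `Γ'`
with the same free variables. -/
def PNFT (T Γ Γ' : Set Form) : Prop :=
  ∀ φ ∈ Γ, ∃ φ' ∈ Γ', φ.fv = φ'.fv ∧ Proves T (Form.iff φ φ')

end HeytingArith

-- For a prenex formula `φ` let the dual `φᵈ` exchange the quantifiers and negate the matrix.
-- Intuitionistically `φᵈ` implies `¬φ`. The converse needs decidability of prenex formulas at lower
-- levels, and with it the usual prenex manipulations become available. Both directions of the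
-- theorem therefore rest on `DecPre` below `k`.
--
-- From principles to normal forms. Σ_k-DNE gives decidability below `k` (`DecPre.of_dne`): for `φ`
-- in Σ_j, `φ ∨ φᵈ` is Σ_{j+1} up to equivalence and its double negation is provable. Then an
-- induction on the level and on the formula (`hasPre_levels`) shows that formulas of E type are
-- equivalent to Σ formulas, and that formulas of U type have negations equivalent to Σ formulas.
-- Normalizing only the negation of a U formula suffices, because under Σ_k-DNE an implication `φ →
-- ψ` can be replaced by `¬φ ∨ ψ`. The one step beyond DNE is `¬∀x φ → ∃x ¬φ` for `φ` of U type, and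
-- this is what DNS supplies.
--
-- From normal forms to principles. If the levels below `j` are decidable in `T`, an implication
-- between Σ_j formulas provable in `PA` is provable in `T` (`conservation`): the negative
-- translation with `⊥` replaced by the conclusion carries a `PA` proof into `HA`. Normal forms
-- extend this to formulas all of whose paths start with `+` (`entails_of_PNFT`). Applied to `¬¬φ →
-- φ` with `φ` in Σ_j it yields DNE, and applied to `¬∀x φ → ∃x ¬φ` it yields DNS. The decidability
-- it requires is built up level by level from Π_{k-1}-LEM and the DNE instances already obtained.
--
-- The schemata have one parameter, whereas the arguments use arbitrary ones. A primitive recursive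
-- pairing function, verified inside `HA`, bridges the gap.

namespace HeytingArith

open FirstOrder.Language

/-! ### Substitution -/

theorem Tm.relabel_eq_subst (t : Tm) (f : ℕ → ℕ) : t.relabel f = t.subst (fun n => Tm.v (f n)) := by
  induction t with
  | var => rfl
  | func g ts ih => simp [Term.subst, ih]

theorem Tm.subst_subst (t : Tm) (σ τ : ℕ → Tm) :
    (t.subst σ).subst τ = t.subst (fun n => (σ n).subst τ) := by
  induction t with
  | var => rfl
  | func g ts ih => simp [Term.subst, ih]

theorem Tm.subst_id (t : Tm) : t.subst Tm.v = t := by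
  induction t with
  | var => rfl
  | func g ts ih => simp [Term.subst, ih]

theorem Tm.subst_congr (t : Tm) {σ τ : ℕ → Tm} (h : ∀ n ∈ t.varFinset, σ n = τ n) :
    t.subst σ = t.subst τ := by
  induction t with
  | var n => exact h n (by simp)
  | func g ts ih =>
    simp only [Term.subst, Term.func.injEq, heq_eq_eq, true_and]
    funext i
    exact ih i fun n hn => h n (by simp only [Term.varFinset, Finset.mem_biUnion]; exact ⟨i, by simp, hn⟩)

theorem Tm.mem_vars_subst (t : Tm) (σ : ℕ → Tm) (m : ℕ) :
    m ∈ (t.subst σ).varFinset ↔ ∃ n ∈ t.varFinset, m ∈ (σ n).varFinset := by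
  induction t with
  | var n => simp [Term.subst]
  | func g ts ih =>
    simp only [Term.subst, Term.varFinset, Finset.mem_biUnion, Finset.mem_univ, true_and, ih]
    exact ⟨fun ⟨i, n, h, h'⟩ => ⟨n, ⟨i, h⟩, h'⟩, fun ⟨n, ⟨i, h⟩, h'⟩ => ⟨i, n, h, h'⟩⟩

namespace Form

@[simp] theorem up_zero (σ : ℕ → Tm) : up σ 0 = Tm.v 0 := rfl

theorem up_succ (σ : ℕ → Tm) (n : ℕ) : up σ (n + 1) = (σ n).subst (fun m => Tm.v (m + 1)) :=
  Tm.relabel_eq_subst _ _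

theorem up_comp (σ τ : ℕ → Tm) :
    (fun n => (up σ n).subst (up τ)) = up (fun n => (σ n).subst τ) := by
  funext n
  cases n with
  | zero => rfl
  | succ n => simp only [up_succ, Tm.subst_subst, Term.subst]

theorem up_v : up Tm.v = Tm.v := by
  funext n; cases n <;> rfl

theorem subst_subst (φ : Form) (σ τ : ℕ → Tm) :
    (φ.subst σ).subst τ = φ.subst (fun n => (σ n).subst τ) := by
  induction φ generalizing σ τ <;> simp_all [subst, Tm.subst_subst, up_comp]

theorem subst_id (φ : Form) : φ.subst Tm.v = φ := by
  induction φ <;> simp_all [subst, Tm.subst_id, up_v]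

theorem subst_congr (φ : Form) {σ τ : ℕ → Tm} (h : ∀ n ∈ φ.fv, σ n = τ n) :
    φ.subst σ = φ.subst τ := by
  induction φ generalizing σ τ with
  | bot => rfl
  | eq s t =>
    simp only [subst, Form.eq.injEq]
    exact ⟨s.subst_congr fun n hn => h n (Or.inl hn), t.subst_congr fun n hn => h n (Or.inr hn)⟩
  | and φ ψ h₁ h₂ | or φ ψ h₁ h₂ | imp φ ψ h₁ h₂ =>
    simp only [subst]
    rw [h₁ fun n hn => h n (Or.inl hn), h₂ fun n hn => h n (Or.inr hn)]
  | all φ h₁ | ex φ h₁ =>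
    simp only [subst]
    rw [h₁]
    rintro (_ | n) hn
    · rfl
    · rw [up_succ, up_succ, h n hn]

theorem mem_fv_subst (φ : Form) (σ : ℕ → Tm) (m : ℕ) :
    m ∈ (φ.subst σ).fv ↔ ∃ n ∈ φ.fv, m ∈ (σ n).varFinset := by
  induction φ generalizing σ m with
  | bot => simp [subst, fv]
  | eq s t =>
    simp only [subst, fv, Set.mem_union, Finset.mem_coe, Tm.mem_vars_subst]
    grind
  | and φ ψ h₁ h₂ | or φ ψ h₁ h₂ | imp φ ψ h₁ h₂ =>
    simp only [subst, fv, Set.mem_union, h₁, h₂]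
    grind
  | all φ h₁ | ex φ h₁ =>
    simp only [subst, fv, Set.mem_ofPred_eq, h₁]
    constructor
    · rintro ⟨_ | n, hn, hm⟩
      · simp at hm
      · rw [up_succ, Tm.mem_vars_subst] at hm
        obtain ⟨l, hl, hm⟩ := hm
        simp at hm
        exact ⟨n, hn, hm ▸ hl⟩
    · rintro ⟨n, hn, hm⟩
      refine ⟨n + 1, hn, ?_⟩
      rw [up_succ, Tm.mem_vars_subst]
      exact ⟨m, hm, by simp⟩

theorem mem_fv_shift (φ : Form) (m : ℕ) : m ∈ φ.shift.fv ↔ ∃ n ∈ φ.fv, m = n + 1 := by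
  simp [shift, mem_fv_subst]

@[simp] theorem succ_mem_fv_shift (φ : Form) (m : ℕ) : m + 1 ∈ φ.shift.fv ↔ m ∈ φ.fv := by
  simp [mem_fv_shift]

theorem exists_fv_bound (φ : Form) : ∃ N, ∀ n ∈ φ.fv, n < N := by
  induction φ with
  | bot => exact ⟨0, by simp [fv]⟩
  | eq s t =>
    refine ⟨(s.varFinset ∪ t.varFinset).sup id + 1, fun n hn => Nat.lt_succ_of_le ?_⟩
    exact Finset.le_sup (f := id) (by simpa [fv] using hn)
  | and φ ψ h₁ h₂ | or φ ψ h₁ h₂ | imp φ ψ h₁ h₂ =>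
    obtain ⟨M, hM⟩ := h₁
    obtain ⟨N, hN⟩ := h₂
    exact ⟨M + N, fun n hn => hn.elim (fun h => (hM n h).trans_le (by omega))
      (fun h => (hN n h).trans_le (by omega))⟩
  | all φ h₁ | ex φ h₁ =>
    obtain ⟨M, hM⟩ := h₁
    exact ⟨M, fun n hn => (Nat.lt_succ_self n).trans (hM _ hn)⟩

theorem shift_subst_up (φ : Form) (σ : ℕ → Tm) : φ.shift.subst (up σ) = (φ.subst σ).shift := by
  simp only [shift, subst_subst, Term.subst, up_succ]

theorem shift_inst (φ : Form) (t : Tm) : φ.shift.inst t = φ := by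
  simp only [shift, inst, subst_subst, Term.subst, single]
  exact subst_id φ

theorem shift_stepSubst (φ : Form) : φ.shift.subst stepSubst = φ.shift := by
  simp only [shift, subst_subst, Term.subst, stepSubst]

theorem subst_up_shift_inst (φ : Form) :
    (φ.subst (up fun n => Tm.v (n + 1))).inst (Tm.v 0) = φ := by
  simp only [inst, subst_subst]
  refine Eq.trans ?_ (subst_id φ)
  congr 1
  funext n
  cases n <;> rfl

end Form

/-! ### Structural properties of derivability -/

namespace Deriv

variable {T : Set Form} {Γ Δ : List Form} {φ ψ χ : Form}

theorem weaken (h : Deriv T Γ φ) : ∀ {Δ : List Form}, Γ ⊆ Δ → Deriv T Δ φ := by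
  induction h with
  | ax h => exact fun _ => .ax h
  | hyp h => exact fun s => .hyp (s h)
  | botE _ ih => exact fun s => .botE (ih s)
  | andI _ _ ih₁ ih₂ => exact fun s => .andI (ih₁ s) (ih₂ s)
  | andE₁ _ ih => exact fun s => .andE₁ (ih s)
  | andE₂ _ ih => exact fun s => .andE₂ (ih s)
  | orI₁ _ ih => exact fun s => .orI₁ (ih s)
  | orI₂ _ ih => exact fun s => .orI₂ (ih s)
  | orE _ _ _ ih₁ ih₂ ih₃ =>
    exact fun s => .orE (ih₁ s) (ih₂ (List.cons_subset_cons _ s)) (ih₃ (List.cons_subset_cons _ s))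
  | impI _ ih => exact fun s => .impI (ih (List.cons_subset_cons _ s))
  | impE _ _ ih₁ ih₂ => exact fun s => .impE (ih₁ s) (ih₂ s)
  | allI _ ih => exact fun s => .allI (ih (List.map_subset _ s))
  | allE t _ ih => exact fun s => .allE t (ih s)
  | exI t _ ih => exact fun s => .exI t (ih s)
  | exE _ _ ih₁ ih₂ =>
    exact fun s => .exE (ih₁ s) (ih₂ (List.cons_subset_cons _ (List.map_subset _ s)))
  | eqRefl t => exact fun _ => .eqRefl t
  | eqSubst φ _ _ ih₁ ih₂ => exact fun s => .eqSubst φ (ih₁ s) (ih₂ s)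

theorem weaken₁ (h : Deriv T Γ φ) : Deriv T (ψ :: Γ) φ := h.weaken (by simp)

theorem ofProves (h : Proves T φ) : Deriv T Γ φ := weaken h (List.nil_subset _)

theorem mono {U : Set Form} (h : Deriv T Γ φ) (hU : ∀ χ ∈ T, Proves U χ) : Deriv U Γ φ := by
  induction h with
  | ax h => exact ofProves (hU _ h)
  | hyp h => exact .hyp h
  | botE _ ih => exact .botE ih
  | andI _ _ ih₁ ih₂ => exact .andI ih₁ ih₂
  | andE₁ _ ih => exact .andE₁ ih
  | andE₂ _ ih => exact .andE₂ ih
  | orI₁ _ ih => exact .orI₁ ih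
  | orI₂ _ ih => exact .orI₂ ih
  | orE _ _ _ ih₁ ih₂ ih₃ => exact .orE ih₁ ih₂ ih₃
  | impI _ ih => exact .impI ih
  | impE _ _ ih₁ ih₂ => exact .impE ih₁ ih₂
  | allI _ ih => exact .allI ih
  | allE t _ ih => exact .allE t ih
  | exI t _ ih => exact .exI t ih
  | exE _ _ ih₁ ih₂ => exact .exE ih₁ ih₂
  | eqRefl t => exact .eqRefl t
  | eqSubst φ _ _ ih₁ ih₂ => exact .eqSubst φ ih₁ ih₂

theorem h0 : Deriv T (φ :: Γ) φ := .hyp (by simp)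
theorem h1 {φ₀} : Deriv T (φ₀ :: φ :: Γ) φ := .hyp (by simp)
theorem h2 {φ₀ φ₁} : Deriv T (φ₀ :: φ₁ :: φ :: Γ) φ := .hyp (by simp)
theorem h3 {φ₀ φ₁ φ₂} : Deriv T (φ₀ :: φ₁ :: φ₂ :: φ :: Γ) φ := .hyp (by simp)

/-- Modus ponens with an implication that is a theorem. -/
theorem mp (h : Proves T (.imp φ ψ)) (h' : Deriv T Γ φ) : Deriv T Γ ψ := .impE (ofProves h) h'

theorem cases_or (h : Proves T (.or φ ψ)) (h₁ : Deriv T (φ :: Γ) χ) (h₂ : Deriv T (ψ :: Γ) χ) :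
    Deriv T Γ χ := .orE (ofProves h) h₁ h₂

theorem absurd (h : Deriv T Γ φ.neg) (h' : Deriv T Γ φ) : Deriv T Γ ψ := .botE (.impE h h')

theorem exI₀ (h : Deriv T Γ φ) : Deriv T Γ (Form.ex φ).shift :=
  .exI (Tm.v 0) (by rwa [Form.subst_up_shift_inst])

theorem allE₀ (h : Deriv T Γ (Form.all φ).shift) : Deriv T Γ φ := by
  have := Deriv.allE (φ := φ.subst (Form.up fun n => Tm.v (n + 1))) (Tm.v 0) h
  rwa [Form.subst_up_shift_inst] at this

/-- The language has a closed term, so vacuous quantifiers may be added and dropped. -/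
theorem exI_shift (h : Deriv T Γ φ) : Deriv T Γ (.ex φ.shift) :=
  .exI Tm.zero (by rwa [Form.shift_inst])

theorem allE_shift (h : Deriv T Γ (.all φ.shift)) : Deriv T Γ φ := by
  have := Deriv.allE Tm.zero h
  rwa [Form.shift_inst] at this

end Deriv

namespace Proves

variable {T : Set Form} {φ ψ : Form}

theorem gen (h : Proves T φ) : Proves T (.all φ) := Deriv.allI h

theorem subst_prefix (n : ℕ) (h : Proves T φ) (ρ : ℕ → Tm) :
    Proves T (φ.subst fun i => if i < n then ρ i else Tm.v (i - n)) := by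
  induction n generalizing φ ρ with
  | zero => simpa [Form.subst_id] using h
  | succ n ih =>
    -- The term `ρ 0` is moved up by `n` because the remaining `n` instantiations lower all later
    -- variables by `n` and so restore it.
    have h' := ih (Deriv.allE ((ρ 0).subst fun m => Tm.v (m + n)) h.gen) (fun i => ρ (i + 1))
    rw [Form.inst, Form.subst_subst] at h'
    convert h' using 2
    funext i
    cases i with
    | zero => simp [Form.single, Tm.subst_subst, Term.subst, Tm.subst_id]
    | succ i => simp [Form.single, Term.subst]

/-- Derivability without assumptions is closed under substitution. -/
theorem subst (h : Proves T φ) (σ : ℕ → Tm) : Proves T (φ.subst σ) := by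
  obtain ⟨N, hN⟩ := φ.exists_fv_bound
  rw [φ.subst_congr (τ := fun i => if i < N then σ i else Tm.v (i - N))
    fun n hn => by simp [hN n hn]]
  exact subst_prefix N h σ

theorem of_all (h : Proves T (.all φ)) : Proves T φ :=
  Deriv.allE₀ (h.subst _)

theorem inst (h : Proves T φ) (t : Tm) : Proves T (φ.inst t) := h.subst _

end Proves


section

/-! ### Provable equivalence and congruence -/

variable {T : Set Form} {Γ : List Form} {φ ψ χ φ' ψ' : Form}

theorem Deriv.app (h : Deriv T [φ] ψ) (h' : Deriv T Γ φ) : Deriv T Γ ψ :=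
  .mp (.impI h) h'

/-- Provable equivalence, as mutual derivability. -/
def Eqv (T : Set Form) (φ ψ : Form) : Prop := Deriv T [φ] ψ ∧ Deriv T [ψ] φ

theorem eqv_iff_proves : Eqv T φ ψ ↔ Proves T (Form.iff φ ψ) :=
  ⟨fun h => .andI (.impI h.1) (.impI h.2),
    fun h => ⟨.mp (Deriv.andE₁ h) .h0, .mp (Deriv.andE₂ h) .h0⟩⟩

namespace Eqv

theorem refl (φ : Form) : Eqv T φ φ := ⟨.h0, .h0⟩

theorem symm (h : Eqv T φ ψ) : Eqv T ψ φ := ⟨h.2, h.1⟩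

theorem trans (h : Eqv T φ ψ) (h' : Eqv T ψ χ) : Eqv T φ χ := ⟨h'.1.app h.1, h.2.app h'.2⟩

theorem and (h : Eqv T φ φ') (h' : Eqv T ψ ψ') : Eqv T (.and φ ψ) (.and φ' ψ') :=
  ⟨.andI (h.1.app (.andE₁ .h0)) (h'.1.app (.andE₂ .h0)),
    .andI (h.2.app (.andE₁ .h0)) (h'.2.app (.andE₂ .h0))⟩

theorem or (h : Eqv T φ φ') (h' : Eqv T ψ ψ') : Eqv T (.or φ ψ) (.or φ' ψ') :=
  ⟨.orE .h0 (.orI₁ (h.1.app .h0)) (.orI₂ (h'.1.app .h0)),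
    .orE .h0 (.orI₁ (h.2.app .h0)) (.orI₂ (h'.2.app .h0))⟩

theorem imp (h : Eqv T φ φ') (h' : Eqv T ψ ψ') : Eqv T (.imp φ ψ) (.imp φ' ψ') :=
  ⟨.impI (h'.1.app (.impE .h1 (h.2.app .h0))), .impI (h'.2.app (.impE .h1 (h.1.app .h0)))⟩

theorem neg (h : Eqv T φ φ') : Eqv T φ.neg φ'.neg := h.imp (refl _)

end Eqv

theorem Deriv.all_mono (h : Deriv T [φ] ψ) : Deriv T [.all φ] (.all ψ) :=
  .allI (h.app (.allE₀ .h0))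

theorem Deriv.ex_mono (h : Deriv T [φ] ψ) : Deriv T [.ex φ] (.ex ψ) :=
  .exE .h0 (.exI₀ (h.app .h0))

namespace Eqv

theorem all (h : Eqv T φ ψ) : Eqv T (.all φ) (.all ψ) := ⟨h.1.all_mono, h.2.all_mono⟩

theorem ex (h : Eqv T φ ψ) : Eqv T (.ex φ) (.ex ψ) := ⟨h.1.ex_mono, h.2.ex_mono⟩

theorem all_shift (φ : Form) : Eqv T φ (.all φ.shift) :=
  ⟨.allI .h0, .allE_shift .h0⟩

theorem ex_shift (φ : Form) : Eqv T φ (.ex φ.shift) :=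
  ⟨.exI_shift .h0, .exE .h0 .h0⟩

theorem and_ex_left (φ ψ : Form) : Eqv T (.and (.ex φ) ψ) (.ex (.and φ ψ.shift)) :=
  ⟨.exE (.andE₁ .h0) (.exI₀ (.andI .h0 (.andE₂ (φ := (Form.ex φ).shift) .h1))),
    .exE .h0 (.andI (ψ := ψ.shift) (.exI₀ (.andE₁ .h0)) (.andE₂ .h0))⟩

theorem and_ex_right (φ ψ : Form) : Eqv T (.and ψ (.ex φ)) (.ex (.and ψ.shift φ)) :=
  ⟨.exE (.andE₂ .h0) (.exI₀ (.andI (.andE₁ (ψ := (Form.ex φ).shift) .h1) .h0)),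
    .exE .h0 (.andI (φ := ψ.shift) (.andE₁ .h0) (.exI₀ (.andE₂ .h0)))⟩

theorem or_ex_left (φ ψ : Form) : Eqv T (.or (.ex φ) ψ) (.ex (.or φ ψ.shift)) :=
  ⟨.orE .h0 (.exE .h0 (.exI₀ (.orI₁ .h0)))
      (.exI Tm.zero (.orI₂ (by change Deriv T _ (ψ.shift.inst Tm.zero); rw [Form.shift_inst]; exact .h0))),
    .exE .h0 (.orE .h0 (.orI₁ (ψ := ψ.shift) (.exI₀ .h0)) (.orI₂ (φ := (Form.ex φ).shift) .h0))⟩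

theorem or_ex_right (φ ψ : Form) : Eqv T (.or ψ (.ex φ)) (.ex (.or ψ.shift φ)) :=
  ⟨.orE .h0
      (.exI Tm.zero (.orI₁ (by change Deriv T _ (ψ.shift.inst Tm.zero); rw [Form.shift_inst]; exact .h0)))
      (.exE .h0 (.exI₀ (.orI₂ .h0))),
    .exE .h0 (.orE .h0 (.orI₁ (ψ := (Form.ex φ).shift) .h0) (.orI₂ (φ := ψ.shift) (.exI₀ .h0)))⟩

end Eqv

/-! ### Prenex formulas with possibly empty blocks -/

/-- The quantifier `∃` for `true`, `∀` for `false`. -/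
def Form.quant : Bool → Form → Form
  | true => .ex
  | false => .all

theorem fv_quant (b : Bool) (φ : Form) : (Form.quant b φ).fv = {n | n + 1 ∈ φ.fv} := by
  cases b <;> rfl

theorem Eqv.quant (b : Bool) (h : Eqv T φ ψ) : Eqv T (Form.quant b φ) (Form.quant b ψ) := by
  cases b
  · exact h.all
  · exact h.ex

theorem Eqv.quant_shift (b : Bool) (φ : Form) : Eqv T φ (Form.quant b φ.shift) := by
  cases b
  · exact all_shift φ
  · exact ex_shift φ

theorem fv_quant_shift (b : Bool) (φ : Form) : (Form.quant b φ.shift).fv = φ.fv := by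
  rw [fv_quant]; ext n; simp

theorem isQF_subst (φ : Form) (σ : ℕ → Tm) : (φ.subst σ).isQF = φ.isQF := by
  induction φ generalizing σ <;> simp_all [Form.subst, Form.isQF]

/-- Prenex formulas with at most `k` blocks of quantifiers, the outermost allowed one being
existential if `b = true` and universal if `b = false`. -/
inductive Pre : Bool → ℕ → Form → Prop
  | qf {b k φ} : φ.isQF = true → Pre b k φ
  | alt {b k φ} : Pre (!b) k φ → Pre b (k + 1) φ
  | quant {b k φ} : Pre b (k + 1) φ → Pre b (k + 1) (Form.quant b φ)

namespace Pre

variable {b : Bool} {k : ℕ}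

theorem isQF_of_zero (h : Pre b 0 φ) : φ.isQF = true := by
  cases h; assumption

-- Induction along the outermost block only: everything one level down, including the
-- quantifier-free case, serves as base.
@[elab_as_elim]
theorem rec_succ {P : Form → Prop} (h : Pre b (k + 1) φ) (base : ∀ φ, Pre (!b) k φ → P φ)
    (quant : ∀ φ, Pre b (k + 1) φ → P φ → P (Form.quant b φ)) : P φ := by
  generalize hm : k + 1 = m at h
  induction h with
  | qf h => exact base _ (.qf h)
  | alt h => cases hm; exact base _ h
  | quant h ih => cases hm; exact quant _ h (ih base quant rfl)

theorem subst (h : Pre b k φ) (σ : ℕ → Tm) : Pre b k (φ.subst σ) := by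
  induction h generalizing σ with
  | qf h => exact .qf (by rwa [isQF_subst])
  | alt _ ih => exact .alt (ih σ)
  | @quant b _ _ _ ih =>
    cases b
    · exact .quant (b := false) (ih _)
    · exact .quant (b := true) (ih _)

theorem succ_same (h : Pre b k φ) : Pre b (k + 1) φ := by
  induction h with
  | qf h => exact .qf h
  | alt _ ih => exact .alt ih
  | quant _ ih => exact .quant ih

theorem succ (h : Pre b k φ) (b' : Bool) : Pre b' (k + 1) φ := by
  by_cases hb : b = b'
  · exact hb ▸ h.succ_same
  · refine .alt ?_
    have : b = !b' := by revert hb; cases b <;> cases b' <;> simp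
    rwa [← this]

theorem mono {l : ℕ} (h : Pre b k φ) (hl : k ≤ l) : Pre b l φ := by
  induction hl with
  | refl => exact h
  | step _ ih => exact ih.succ_same

theorem of_lt {l : ℕ} (h : Pre b k φ) (hl : k < l) (b' : Bool) : Pre b' l φ :=
  (h.succ b').mono hl

end Pre

/-- `Σ_k` for `true`, `Π_k` for `false`. -/
def prenexClass (b : Bool) (k : ℕ) : Set Form := if b then SigmaC k else PiC k

theorem mem_prenexClass_zero {b : Bool} : φ ∈ prenexClass b 0 ↔ φ.isQF = true := by
  cases b <;> simp [prenexClass, SigmaC, PiC]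

theorem mem_prenexClass_succ {b : Bool} {k : ℕ} : φ ∈ prenexClass b (k + 1) ↔
    ∃ n : ℕ, ∃ ψ ∈ prenexClass (!b) k, φ = (Form.quant b)^[n + 1] ψ := by
  cases b <;> simp [prenexClass, SigmaC, PiC, Form.quant]

theorem pre_of_mem_prenexClass {b : Bool} {k : ℕ} (h : φ ∈ prenexClass b k) : Pre b k φ := by
  induction k generalizing b φ with
  | zero => exact .qf (mem_prenexClass_zero.1 h)
  | succ k ih =>
    obtain ⟨n, ψ, hψ, rfl⟩ := mem_prenexClass_succ.1 h
    generalize n + 1 = n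
    induction n with
    | zero => exact .alt (ih hψ)
    | succ n ihn => rw [Function.iterate_succ_apply']; exact .quant ihn

theorem subst_mem_prenexClass {b : Bool} {k : ℕ} (h : φ ∈ prenexClass b k) (σ : ℕ → Tm) :
    φ.subst σ ∈ prenexClass b k := by
  induction k generalizing b φ σ with
  | zero => rw [mem_prenexClass_zero] at *; rwa [isQF_subst]
  | succ k ih =>
    obtain ⟨n, ψ, hψ, rfl⟩ := mem_prenexClass_succ.1 h
    refine mem_prenexClass_succ.2 ⟨n, ψ.subst (Form.up^[n + 1] σ), ih hψ _, ?_⟩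
    clear h
    generalize n + 1 = n
    induction n generalizing σ with
    | zero => rfl
    | succ n ihn =>
      rw [Function.iterate_succ_apply', Function.iterate_succ_apply', Function.iterate_succ_apply,
        ← ihn]
      cases b <;> rfl

theorem exists_prenexClass_succ {b : Bool} {k : ℕ}
    (h : ∃ φ' ∈ prenexClass (!b) k, φ.fv = φ'.fv ∧ Eqv T φ φ') :
    ∃ φ' ∈ prenexClass b (k + 1), φ.fv = φ'.fv ∧ Eqv T φ φ' := by
  obtain ⟨φ', h, hf, he⟩ := h
  exact ⟨_, mem_prenexClass_succ.2 ⟨0, _, subst_mem_prenexClass h _, rfl⟩,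
    hf.trans (fv_quant_shift b φ').symm, he.trans (.quant_shift b φ')⟩

/-- Missing blocks are filled with vacuous quantifiers, which affect neither the meaning nor the
free variables. -/
theorem Pre.exists_prenexClass {b : Bool} {k : ℕ} (h : Pre b k φ) :
    ∃ φ' ∈ prenexClass b k, φ.fv = φ'.fv ∧ Eqv T φ φ' := by
  induction h with
  | @qf b k φ h =>
    induction k generalizing b with
    | zero => exact ⟨φ, mem_prenexClass_zero.2 h, rfl, .refl _⟩
    | succ k ih => exact exists_prenexClass_succ ih
  | alt _ ih => exact exists_prenexClass_succ ih
  | @quant b k φ _ ih =>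
    obtain ⟨φ', h', hf, he⟩ := ih
    obtain ⟨n, ψ, hψ, rfl⟩ := mem_prenexClass_succ.1 h'
    refine ⟨_, mem_prenexClass_succ.2 ⟨n + 1, ψ, hψ, rfl⟩, ?_, ?_⟩
    · rw [Function.iterate_succ_apply', fv_quant, fv_quant, hf]
    · rw [Function.iterate_succ_apply']; exact he.quant b

/-! ### Dual prenex formulas and decidability -/

/-- The dual of a prenex formula: quantifiers are exchanged and the matrix is negated. -/
def Form.dual : Form → Form
  | .all φ => .ex φ.dual
  | .ex φ => .all φ.dual
  | φ => φ.neg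

theorem dual_of_isQF (h : φ.isQF = true) : φ.dual = φ.neg := by
  cases φ <;> simp_all [Form.dual, Form.isQF]

theorem dual_quant (b : Bool) (φ : Form) : (Form.quant b φ).dual = Form.quant (!b) φ.dual := by
  cases b <;> rfl

theorem fv_neg (φ : Form) : φ.neg.fv = φ.fv := by simp [Form.neg, Form.fv]

theorem fv_dual (φ : Form) : φ.dual.fv = φ.fv := by
  induction φ <;> simp_all [Form.dual, fv_neg, Form.fv]

theorem isQF_neg (φ : Form) : φ.neg.isQF = φ.isQF := by simp [Form.neg, Form.isQF]

theorem Pre.dual {b : Bool} {k : ℕ} (h : Pre b k φ) : Pre (!b) k φ.dual := by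
  induction h with
  | qf h => rw [dual_of_isQF h]; exact .qf (by rwa [isQF_neg])
  | alt _ ih => exact .alt ih
  | quant _ ih => rw [dual_quant]; exact .quant ih

theorem dual_imp_neg (φ : Form) : Deriv T [φ.dual] φ.neg := by
  induction φ with
  | all φ ih => exact .exE .h0 (.impI (.impE (ih.app .h1) (.allE₀ .h0)))
  | ex φ ih => exact .impI (.exE .h0 (.impE (ih.app (.allE₀ .h2)) .h0))
  | _ => exact .h0

theorem Deriv.dual_absurd (h : Deriv T Γ φ.dual) (h' : Deriv T Γ φ) : Deriv T Γ ψ :=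
  .absurd ((dual_imp_neg φ).app h) h'

/-- `φ` is decidable in `T`. -/
def Dec (T : Set Form) (φ : Form) : Prop := Proves T (.or φ φ.neg)

/-- All formulas in `Pre _ k` are decidable in `T`. -/
def DecPre (T : Set Form) (k : ℕ) : Prop := ∀ ⦃b φ⦄, Pre b k φ → Dec T φ

theorem Dec.stable (h : Dec T φ) : Deriv T [φ.neg.neg] φ :=
  .cases_or h .h0 (.absurd .h1 .h0)

theorem Dec.congr (h : Dec T φ) (e : Eqv T φ ψ) : Dec T ψ :=
  (Eqv.or e e.neg).1.app h

theorem dec_of_isQF (heq : ∀ s t, Dec T (.eq s t)) (h : φ.isQF = true) : Dec T φ := by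
  induction φ with
  | bot => exact .orI₂ (.impI .h0)
  | eq s t => exact heq s t
  | and φ ψ ih₁ ih₂ =>
    simp only [Form.isQF, Bool.and_eq_true] at h
    exact .cases_or (ih₁ h.1)
      (.cases_or (ih₂ h.2) (.orI₁ (.andI .h1 .h0)) (.orI₂ (.impI (.impE .h1 (.andE₂ .h0)))))
      (.orI₂ (.impI (.impE .h1 (.andE₁ .h0))))
  | or φ ψ ih₁ ih₂ =>
    simp only [Form.isQF, Bool.and_eq_true] at h
    exact .cases_or (ih₁ h.1) (.orI₁ (.orI₁ .h0))
      (.cases_or (ih₂ h.2) (.orI₁ (.orI₂ .h0))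
        (.orI₂ (.impI (.orE .h0 (.impE .h3 .h0) (.impE .h2 .h0)))))
  | imp φ ψ ih₁ ih₂ =>
    simp only [Form.isQF, Bool.and_eq_true] at h
    exact .cases_or (ih₁ h.1)
      (.cases_or (ih₂ h.2) (.orI₁ (.impI .h1)) (.orI₂ (.impI (.impE .h1 (.impE .h0 .h2)))))
      (.orI₁ (.impI (.absurd .h1 .h0)))
  | all | ex => simp [Form.isQF] at h

/-- A negation passes an existential quantifier freely, but a universal one only by case
distinctions on the dual and on the body. Hence an outer universal block costs decidability at level
`k` itself, an outer existential block only below `k`. -/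
theorem Pre.neg_imp_dual {b : Bool} {k : ℕ} (h : Pre b k φ) (hd : ∀ i < k, DecPre T i)
    (hb : b = true ∨ DecPre T k) : Deriv T [φ.neg] φ.dual := by
  induction h with
  | qf h => rw [dual_of_isQF h]; exact .h0
  | @alt b k φ _ ih =>
    exact ih (fun i hi => hd i (by omega)) (Or.inr (hd k (by omega)))
  | @quant b k φ hφ ih =>
    have ihn := ih hd hb
    cases b with
    | true => exact .allI (ihn.app (.impI (.impE .h1 (.exI₀ .h0))))
    | false =>
      have hk : DecPre T (k + 1) := by simpa using hb
      refine .cases_or (hk (Pre.quant hφ.dual)) .h0 (.absurd .h1 (.allI ?_))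
      exact .cases_or (hk hφ) .h0 (.absurd .h1 (.exI₀ (ihn.app .h0)))

theorem Pre.neg_eqv_dual {b : Bool} {k : ℕ} (h : Pre b k φ) (hd : ∀ i < k, DecPre T i)
    (hb : b = true ∨ DecPre T k) : Eqv T φ.neg φ.dual :=
  ⟨h.neg_imp_dual hd hb, dual_imp_neg φ⟩

/-! ### Formulas with a prenex normal form -/

/-- `φ` is equivalent in `T` to a formula in `Pre b k` with the same free variables. -/
def HasPre (T : Set Form) (b : Bool) (k : ℕ) (φ : Form) : Prop :=
  ∃ φ', Pre b k φ' ∧ φ.fv = φ'.fv ∧ Eqv T φ φ'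

theorem Pre.hasPre {b : Bool} {k : ℕ} (h : Pre b k φ) : HasPre T b k φ := ⟨φ, h, rfl, .refl φ⟩

namespace HasPre

variable {b : Bool} {k : ℕ}

theorem congr (h : HasPre T b k ψ) (hf : φ.fv = ψ.fv) (he : Eqv T φ ψ) : HasPre T b k φ := by
  obtain ⟨χ, h, hf', he'⟩ := h
  exact ⟨χ, h, hf.trans hf', he.trans he'⟩

theorem of_lt {l : ℕ} (h : HasPre T b k φ) (hl : k < l) (b' : Bool) : HasPre T b' l φ := by
  obtain ⟨χ, h, hf, he⟩ := h
  exact ⟨χ, h.of_lt hl b', hf, he⟩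

theorem quant (h : HasPre T b (k + 1) φ) : HasPre T b (k + 1) (Form.quant b φ) := by
  obtain ⟨χ, h, hf, he⟩ := h
  exact ⟨_, h.quant, by rw [fv_quant, fv_quant, hf], he.quant b⟩

theorem neg (h : HasPre T b k φ) (hd : ∀ i < k, DecPre T i) (hb : b = true ∨ DecPre T k) :
    HasPre T (!b) k φ.neg := by
  obtain ⟨χ, h, hf, he⟩ := h
  exact ⟨_, h.dual, by rw [fv_neg, fv_dual, hf], he.neg.trans (h.neg_eqv_dual hd hb)⟩

/-- Existential quantifiers are pulled out of the two arguments in turn, so a connective has to be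
treated only for Π_k arguments. -/
theorem ex_induction {op : Form → Form → Form}
    (hl : ∀ φ ψ, Eqv T (op (.ex φ) ψ) (.ex (op φ ψ.shift)))
    (hr : ∀ φ ψ, Eqv T (op ψ (.ex φ)) (.ex (op ψ.shift φ)))
    (hf : ∀ φ ψ, (op φ ψ).fv = φ.fv ∪ ψ.fv)
    (base : ∀ φ ψ, Pre false k φ → Pre false k ψ → HasPre T true (k + 1) (op φ ψ))
    (h : Pre true (k + 1) φ) (h' : Pre true (k + 1) ψ) : HasPre T true (k + 1) (op φ ψ) := by
  have key : ∀ φ ψ, Pre false k φ → Pre true (k + 1) ψ → HasPre T true (k + 1) (op φ ψ) := by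
    intro φ ψ h h'
    refine h'.rec_succ (P := fun ψ => ∀ φ, Pre false k φ → HasPre T true (k + 1) (op φ ψ))
      (fun ψ hψ φ hφ => base φ ψ hφ hψ) (fun ψ hψ ih φ hφ => ?_) φ h
    refine (ih φ.shift (hφ.subst _)).quant.congr ?_ (hr ψ φ)
    rw [hf, fv_quant, fv_quant, hf]
    ext n; simp
  refine h.rec_succ (P := fun φ => ∀ ψ, Pre true (k + 1) ψ → HasPre T true (k + 1) (op φ ψ))
    (fun φ hφ ψ hψ => key φ ψ hφ hψ) (fun φ hφ ih ψ hψ => ?_) ψ h'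
  refine (ih ψ.shift (hψ.subst _)).quant.congr ?_ (hl φ ψ)
  rw [hf, fv_quant, fv_quant, hf]
  ext n; simp

/-- The two connectives need a joint induction. On Π_k arguments, De Morgan turns each into the
negation of the other one applied to the Σ_k duals; decidability at level `k` makes these laws
valid. -/
theorem and_or_of_pre (hd : ∀ i < k, DecPre T i) (h : Pre true k φ) (h' : Pre true k ψ) :
    HasPre T true k (.and φ ψ) ∧ HasPre T true k (.or φ ψ) := by
  induction k generalizing φ ψ with
  | zero =>
    exact ⟨(Pre.qf (by simp [Form.isQF, h.isQF_of_zero, h'.isQF_of_zero])).hasPre,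
      (Pre.qf (by simp [Form.isQF, h.isQF_of_zero, h'.isQF_of_zero])).hasPre⟩
  | succ k ih =>
    have hk := hd k (by omega)
    have hd' : ∀ i < k, DecPre T i := fun i hi => hd i (by omega)
    have stab : ∀ {φ}, Pre false k φ → Deriv T [φ.dual.neg] φ := fun hφ =>
      .cases_or (hk hφ) .h0 (.absurd .h1 ((hφ.neg_imp_dual hd' (.inr hk)).app .h0))
    constructor
    · refine ex_induction Eqv.and_ex_left Eqv.and_ex_right (fun _ _ => rfl) (fun φ ψ hφ hψ => ?_) h h'
      refine HasPre.of_lt (((ih hd' hφ.dual hψ.dual).2.neg hd' (.inl rfl)).congr ?_ ⟨?_, ?_⟩)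
        k.lt_succ_self true
      · rw [fv_neg]; simp [Form.fv, fv_dual]
      · exact .impI (.orE .h0 (.dual_absurd .h0 (.andE₁ .h2)) (.dual_absurd .h0 (.andE₂ .h2)))
      · exact .andI ((stab hφ).app (.impI (.impE .h1 (.orI₁ .h0))))
          ((stab hψ).app (.impI (.impE .h1 (.orI₂ .h0))))
    · refine ex_induction Eqv.or_ex_left Eqv.or_ex_right (fun _ _ => rfl) (fun φ ψ hφ hψ => ?_) h h'
      refine HasPre.of_lt (((ih hd' hφ.dual hψ.dual).1.neg hd' (.inl rfl)).congr ?_ ⟨?_, ?_⟩)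
        k.lt_succ_self true
      · rw [fv_neg]; simp [Form.fv, fv_dual]
      · exact .impI (.orE .h1 (.dual_absurd (.andE₁ .h1) .h0) (.dual_absurd (.andE₂ .h1) .h0))
      · refine .cases_or (hk hφ) (.orI₁ .h0) (.orI₂ ((stab hψ).app (.impI (.impE .h2 (.andI ?_ .h0)))))
        exact (hφ.neg_imp_dual hd' (.inr hk)).app .h1

theorem and (hd : ∀ i < k, DecPre T i) (h : HasPre T true k φ) (h' : HasPre T true k ψ) :
    HasPre T true k (.and φ ψ) := by
  obtain ⟨φ', h, hf, he⟩ := h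
  obtain ⟨ψ', h', hf', he'⟩ := h'
  exact (and_or_of_pre hd h h').1.congr (by simp [Form.fv, hf, hf']) (he.and he')

theorem or (hd : ∀ i < k, DecPre T i) (h : HasPre T true k φ) (h' : HasPre T true k ψ) :
    HasPre T true k (.or φ ψ) := by
  obtain ⟨φ', h, hf, he⟩ := h
  obtain ⟨ψ', h', hf', he'⟩ := h'
  exact (and_or_of_pre hd h h').2.congr (by simp [Form.fv, hf, hf']) (he.or he')

end HasPre

end

/-! ### Equational reasoning -/

section Equality

variable {T : Set Form} {Γ : List Form}

theorem Tm.shift_subst_single (s t : Tm) : (s.subst fun n => Tm.v (n + 1)).subst (Form.single t) = s := by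
  simp only [Tm.subst_subst, Term.subst, Form.single]
  exact s.subst_id

theorem Deriv.eqSymm {s t : Tm} (h : Deriv T Γ (.eq s t)) : Deriv T Γ (.eq t s) := by
  have := Deriv.eqSubst (.eq (Tm.v 0) (s.subst fun n => Tm.v (n + 1))) h
  simp only [Form.inst, Form.subst, Tm.shift_subst_single] at this
  exact this (.eqRefl s)

theorem Deriv.eqTrans {s t u : Tm} (h : Deriv T Γ (.eq s t)) (h' : Deriv T Γ (.eq t u)) :
    Deriv T Γ (.eq s u) := by
  have := Deriv.eqSubst (.eq (s.subst fun n => Tm.v (n + 1)) (Tm.v 0)) h'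
  simp only [Form.inst, Form.subst, Tm.shift_subst_single] at this
  exact this h

theorem Deriv.eqHole (c : Tm) {s t : Tm} (h : Deriv T Γ (.eq s t)) :
    Deriv T Γ (.eq (c.subst (Form.single s)) (c.subst (Form.single t))) := by
  have := Deriv.eqSubst (.eq ((c.subst (Form.single s)).subst fun n => Tm.v (n + 1)) c) h
  simp only [Form.inst, Form.subst, Tm.shift_subst_single] at this
  exact this (.eqRefl _)

theorem Deriv.eqApp {n : ℕ} (f : PRFun n) {ts us : Fin n → Tm}
    (h : ∀ i, Deriv T Γ (.eq (ts i) (us i))) : Deriv T Γ (.eq (Tm.app f ts) (Tm.app f us)) := by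
  -- The arguments are replaced one at a time; `m` counts those already replaced.
  have key : ∀ m ≤ n, Deriv T Γ (.eq (Tm.app f ts) (Tm.app f fun i => if i < m then us i else ts i)) := by
    intro m
    induction m with
    | zero => intro _; simpa using Deriv.eqRefl _
    | succ m ih =>
      intro hm
      refine (ih (by omega)).eqTrans ?_
      have := Deriv.eqHole (Tm.app f fun i => if i = (m : ℕ) then Tm.v 0 else
        (if i < m then us i else ts i).subst fun n => Tm.v (n + 1)) (h ⟨m, hm⟩)
      simp only [Term.subst] at this
      convert this using 3 <;>
      · funext i
        by_cases hi : (i : ℕ) = m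
        · subst hi; simp [Term.subst, Form.single]
        · have : (i : ℕ) < m + 1 ↔ (i : ℕ) < m := by omega
          simp only [hi, if_false, Tm.shift_subst_single, this]
  convert key n le_rfl using 3
  funext i
  simp

/-- The equations are theorems, not assumptions, so they survive the shift of variables under a
quantifier. -/
theorem Proves.eqv_subst {σ τ : ℕ → Tm} (h : ∀ i, Proves T (.eq (σ i) (τ i))) (φ : Form) :
    Eqv T (φ.subst σ) (φ.subst τ) := by
  have hup : ∀ {σ τ : ℕ → Tm}, (∀ i, Proves T (.eq (σ i) (τ i))) →
      ∀ i, Proves T (.eq (Form.up σ i) (Form.up τ i)) := by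
    rintro σ τ h (_ | i)
    · exact .eqRefl _
    · rw [Form.up_succ, Form.up_succ]
      exact (h i).subst _
  induction φ generalizing σ τ with
  | bot => exact .refl _
  | eq s t =>
    have ht : ∀ t : Tm, Proves T (.eq (t.subst σ) (t.subst τ)) := by
      intro t
      induction t with
      | var n => exact h n
      | func f ts ih => exact .eqApp f ih
    exact ⟨(Deriv.ofProves (ht s)).eqSymm.eqTrans (Deriv.h0.eqTrans (.ofProves (ht t))),
      (Deriv.ofProves (ht s)).eqTrans (Deriv.h0.eqTrans (Deriv.ofProves (ht t)).eqSymm)⟩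
  | and φ ψ ih₁ ih₂ => exact (ih₁ h).and (ih₂ h)
  | or φ ψ ih₁ ih₂ => exact (ih₁ h).or (ih₂ h)
  | imp φ ψ ih₁ ih₂ => exact (ih₁ h).imp (ih₂ h)
  | all φ ih => exact (ih (hup h)).all
  | ex φ ih => exact (ih (hup h)).ex

end Equality

theorem Tm.succ_subst (t : Tm) (σ : ℕ → Tm) : (Tm.succ t).subst σ = Tm.succ (t.subst σ) := by
  simp only [Tm.succ, Term.subst, Term.func.injEq, heq_eq_eq, true_and]
  funext i; fin_cases i; rfl

theorem Tm.zero_subst (σ : ℕ → Tm) : Tm.zero.subst σ = Tm.zero := by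
  simp only [Tm.zero, Term.subst, Term.func.injEq, heq_eq_eq, true_and]
  funext i; exact i.elim0

theorem HA.induction {Γ : List Form} {φ : Form} (h₀ : Deriv HA Γ (φ.inst Tm.zero))
    (h₁ : Deriv HA (φ :: Γ.map Form.shift) (φ.subst Form.stepSubst)) : Deriv HA Γ (.all φ) :=
  .impE (.impE (.ax (HAAxiom.induction φ)) h₀) (.allI (.impI h₁))

/-! ### Terms modulo provable equality -/

/-- Provable equality in `HA` from the assumptions `Γ`. -/
def tmSetoid (Γ : List Form) : Setoid Tm where
  r s t := Deriv HA Γ (.eq s t)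
  iseqv := ⟨fun t => .eqRefl t, fun h => h.eqSymm, fun h h' => h.eqTrans h'⟩

/-- Terms modulo provable equality in `HA` from the assumptions `Γ`. -/
def TmQ (Γ : List Form) : Type := Quotient (tmSetoid Γ)

namespace TmQ

variable {Γ : List Form}

/-- The class of a term. -/
def mk (t : Tm) : TmQ Γ := Quotient.mk (tmSetoid Γ) t

/-- The purpose of the quotient: derivations of equations become computations by rewriting. -/
theorem mk_eq_mk {s t : Tm} : (mk s : TmQ Γ) = mk t ↔ Deriv HA Γ (.eq s t) :=
  ⟨fun h => Quotient.exact (s := tmSetoid Γ) h, fun h => Quotient.sound (s := tmSetoid Γ) h⟩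

theorem exists_mk (q : TmQ Γ) : ∃ t, mk t = q := Quotient.exists_rep q

/-- Function symbols act on classes of terms. -/
noncomputable def ap {n : ℕ} (f : PRFun n) (q : Fin n → TmQ Γ) : TmQ Γ :=
  mk (Tm.app f fun i => (exists_mk (q i)).choose)

theorem ap_mk {n : ℕ} (f : PRFun n) (ts : Fin n → Tm) :
    ap f (fun i => (mk (ts i) : TmQ Γ)) = mk (Tm.app f ts) :=
  mk_eq_mk.2 (.eqApp f fun i => mk_eq_mk.1 (exists_mk (mk (ts i) : TmQ Γ)).choose_spec)

theorem exists_fun {n : ℕ} (q : Fin n → TmQ Γ) : ∃ ts : Fin n → Tm, q = fun i => mk (ts i) :=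
  ⟨fun i => (exists_mk (q i)).choose, funext fun i => (exists_mk (q i)).choose_spec.symm⟩

/-- The class of the constant `0`. -/
noncomputable def zero : TmQ Γ := ap PRFun.zero ![]

/-- The successor on classes of terms. -/
noncomputable def succ (q : TmQ Γ) : TmQ Γ := ap PRFun.succ ![q]

theorem mk_zero : mk Tm.zero = (zero : TmQ Γ) := by
  rw [Tm.zero, ← ap_mk, zero]; congr 1; funext i; exact i.elim0

theorem mk_succ (t : Tm) : mk t.succ = succ (mk t : TmQ Γ) := by
  rw [Tm.succ, ← ap_mk, succ]; congr 1; funext i; fin_cases i; rfl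

theorem ap_proj {n : ℕ} (i : Fin n) (q : Fin n → TmQ Γ) : ap (.proj i) q = q i := by
  obtain ⟨ts, rfl⟩ := exists_fun q
  rw [ap_mk]
  exact mk_eq_mk.2 (.ax (HAAxiom.proj i ts))

theorem ap_comp {m n : ℕ} (f : PRFun m) (g : Fin m → PRFun n) (q : Fin n → TmQ Γ) :
    ap (.comp f g) q = ap f fun j => ap (g j) q := by
  obtain ⟨ts, rfl⟩ := exists_fun q
  simp only [ap_mk]
  exact mk_eq_mk.2 (.ax (HAAxiom.comp f g ts))

theorem mk_cons {n : ℕ} (t : Tm) (ts : Fin n → Tm) :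
    (Fin.cons (mk t) fun i => mk (ts i) : Fin (n + 1) → TmQ Γ) =
      fun i => mk ((Fin.cons t ts : Fin (n + 1) → Tm) i) := by
  funext i; refine Fin.cases ?_ (fun i => ?_) i <;> simp

theorem ap_prec_zero {n : ℕ} (f : PRFun n) (g : PRFun (n + 2)) (q : Fin n → TmQ Γ) :
    ap (.prec f g) (Matrix.vecCons zero q) = ap f q := by
  obtain ⟨ts, rfl⟩ := exists_fun q
  rw [← mk_zero, Matrix.vecCons, mk_cons, ap_mk, ap_mk]
  exact mk_eq_mk.2 (.ax (HAAxiom.prec_zero f g ts))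

theorem ap_prec_succ {n : ℕ} (f : PRFun n) (g : PRFun (n + 2)) (x : TmQ Γ) (q : Fin n → TmQ Γ) :
    ap (.prec f g) (Matrix.vecCons (succ x) q) =
      ap g (Matrix.vecCons x (Matrix.vecCons (ap (.prec f g) (Matrix.vecCons x q)) q)) := by
  obtain ⟨ts, rfl⟩ := exists_fun q
  obtain ⟨t, rfl⟩ := exists_mk x
  simp only [← mk_succ, Matrix.vecCons, mk_cons, ap_mk]
  exact mk_eq_mk.2 (.ax (HAAxiom.prec_succ f g t ts))

theorem ap_comp₀ {n : ℕ} (q : Fin n → TmQ Γ) : ap (.comp .zero ![]) q = zero := by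
  rw [ap_comp, zero]; congr 1; funext i; exact i.elim0

theorem ap_comp₁ {n : ℕ} (f : PRFun 1) (g : PRFun n) (q : Fin n → TmQ Γ) :
    ap (.comp f ![g]) q = ap f ![ap g q] := by
  rw [ap_comp]; congr 1; funext i; fin_cases i; rfl

theorem ap_comp₂ {n : ℕ} (f : PRFun 2) (g g' : PRFun n) (q : Fin n → TmQ Γ) :
    ap (.comp f ![g, g']) q = ap f ![ap g q, ap g' q] := by
  rw [ap_comp]; congr 1; funext i; fin_cases i <;> rfl

theorem ap_zero (q : Fin 0 → TmQ Γ) : ap .zero q = zero := by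
  rw [zero]; congr 1; funext i; exact i.elim0

/-- The value of a term under an assignment of classes of terms. -/
noncomputable def val (ρ : ℕ → TmQ Γ) : Tm → TmQ Γ
  | .var n => ρ n
  | .func f ts => ap f fun i => val ρ (ts i)

theorem val_mk (σ : ℕ → Tm) (t : Tm) : val (fun n => (mk (σ n) : TmQ Γ)) t = mk (t.subst σ) := by
  induction t with
  | var n => rfl
  | func f ts ih =>
    simp only [val, ih]
    exact ap_mk f _

theorem val_var (ρ : ℕ → TmQ Γ) (n : ℕ) : val ρ (Tm.v n) = ρ n := rfl

theorem val_app₁ (ρ : ℕ → TmQ Γ) (f : PRFun 1) (s : Tm) :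
    val ρ (Tm.app f ![s]) = ap f ![val ρ s] := by
  simp only [val]; congr 1; funext i; fin_cases i; rfl

theorem val_app₂ (ρ : ℕ → TmQ Γ) (f : PRFun 2) (s t : Tm) :
    val ρ (Tm.app f ![s, t]) = ap f ![val ρ s, val ρ t] := by
  simp only [val]; congr 1; funext i; fin_cases i <;> rfl

theorem val_zero (ρ : ℕ → TmQ Γ) : val ρ Tm.zero = zero := by
  simp only [Tm.zero, Tm.app, val]; exact ap_zero _

theorem val_succ (ρ : ℕ → TmQ Γ) (t : Tm) : val ρ t.succ = succ (val ρ t) := val_app₁ ρ _ t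

/-- The assignment of `x` to the variable `0`, and of `ρ n` to the variable `n + 1`. -/
def cons (x : TmQ Γ) (ρ : ℕ → TmQ Γ) : ℕ → TmQ Γ
  | 0 => x
  | n + 1 => ρ n

theorem cons_zero (x : TmQ Γ) (ρ : ℕ → TmQ Γ) : cons x ρ 0 = x := rfl
theorem cons_one (x : TmQ Γ) (ρ : ℕ → TmQ Γ) : cons x ρ 1 = ρ 0 := rfl
theorem cons_two (x : TmQ Γ) (ρ : ℕ → TmQ Γ) : cons x ρ 2 = ρ 1 := rfl

/-- Induction for equations. -/
theorem eq_induction (s t : Tm)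
    (h₀ : ∀ (Γ : List Form) (ρ : ℕ → TmQ Γ), val (cons zero ρ) s = val (cons zero ρ) t)
    (h₁ : ∀ (Γ : List Form) (x : TmQ Γ) (ρ : ℕ → TmQ Γ),
      val (cons x ρ) s = val (cons x ρ) t → val (cons (succ x) ρ) s = val (cons (succ x) ρ) t)
    (x : TmQ Γ) (ρ : ℕ → TmQ Γ) : val (cons x ρ) s = val (cons x ρ) t := by
  -- The equation is proved by formal induction on the variable `0`, then instantiated at
  -- representatives of `x` and `ρ`. The induction step takes place in a context containing the
  -- equation itself, which is why the hypotheses range over every `Γ`.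
  have key : Proves HA (.eq s t) := by
    refine Proves.of_all (HA.induction (mk_eq_mk.1 ?_) (mk_eq_mk.1 ?_))
    · rw [← val_mk, ← val_mk]
      convert h₀ [] (fun n => mk (Tm.v n)) using 2 <;>
      · funext n; cases n
        · exact mk_zero
        · rfl
    · have hc : (fun n => (mk (Form.stepSubst n) : TmQ (Form.eq s t :: ([] : List Form).map Form.shift))) =
          cons (succ (mk (Tm.v 0))) (fun n => mk (Tm.v (n + 1))) := by
        funext n; cases n
        · exact mk_succ _
        · rfl
      have hc' : (fun n => (mk (Tm.v n) : TmQ (Form.eq s t :: ([] : List Form).map Form.shift))) =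
          cons (mk (Tm.v 0)) (fun n => mk (Tm.v (n + 1))) := by
        funext n; cases n <;> rfl
      rw [← val_mk, ← val_mk, hc]
      refine h₁ _ _ _ ?_
      rw [← hc', val_mk, val_mk, Tm.subst_id, Tm.subst_id]
      exact mk_eq_mk.2 .h0
  obtain ⟨σ, hσ⟩ : ∃ σ : ℕ → Tm, cons x ρ = fun n => mk (σ n) :=
    ⟨fun n => (exists_mk (cons x ρ n)).choose,
      funext fun n => (exists_mk (cons x ρ n)).choose_spec.symm⟩
  rw [hσ, val_mk, val_mk]
  exact mk_eq_mk.2 (.ofProves (key.subst σ))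

end TmQ

/-! ### A pairing function -/

namespace PRFun

/-- Addition. -/
def add : PRFun 2 := prec (proj 0) (comp succ ![proj 1])
/-- The characteristic function of `0`. -/
def isZero : PRFun 1 := prec (comp succ ![zero]) (comp zero ![])
/-- The remainder modulo two. -/
def odd : PRFun 1 := prec zero (comp isZero ![proj 1])
/-- The integral half. -/
def half : PRFun 1 := prec zero (comp add ![comp odd ![proj 0], proj 1])
/-- `z` if the first argument is `0`, the half of `z` otherwise. -/
def halfIf : PRFun 2 := prec (proj 0) (comp half ![proj 2])
/-- The half of an odd number; even numbers are fixed. -/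
def strip : PRFun 1 := comp halfIf ![odd, proj 0]
/-- Iteration of `strip`. -/
def strips : PRFun 2 := prec (proj 0) (comp strip ![proj 1])
/-- The number of odd numbers met in an iteration of `strip`. -/
def count : PRFun 2 :=
  prec (comp zero ![]) (comp add ![proj 1, comp odd ![comp strips ![proj 0, proj 2]]])
/-- Doubling. -/
def double : PRFun 1 := prec zero (comp succ ![comp succ ![proj 1]])
/-- The pairing function `p(0, y) = 2y`, `p(x + 1, y) = 2p(x, y) + 1`. -/
def pair : PRFun 2 := prec double (comp succ ![comp double ![proj 1]])
/-- The difference of `p(x, y)` and `x`. -/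
def pairSub : PRFun 2 := prec double (comp add ![comp pair ![proj 0, proj 2], proj 1])
/-- The first component of a pair. -/
def fst : PRFun 1 := comp count ![proj 0, proj 0]
/-- The second component of a pair. -/
def snd : PRFun 1 := comp half ![comp strips ![proj 0, proj 0]]

end PRFun

namespace TmQ

variable {Γ : List Form}

section Equations

variable (x y z : TmQ Γ)

theorem add_zero' : ap .add ![zero, y] = y := by
  simp [PRFun.add, ap_prec_zero, ap_proj]
theorem add_succ' : ap .add ![succ x, y] = succ (ap .add ![x, y]) := by
  conv_lhs => rw [PRFun.add, ap_prec_succ, ap_comp₁, ap_proj]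
  rfl
theorem isZero_zero : ap .isZero ![zero] = succ (zero : TmQ Γ) := by
  rw [PRFun.isZero, ap_prec_zero, ap_comp₁, ap_zero]; rfl
theorem isZero_succ : ap .isZero ![succ x] = zero := by
  rw [PRFun.isZero, ap_prec_succ, ap_comp₀]
theorem odd_zero : ap .odd ![zero] = (zero : TmQ Γ) := by
  rw [PRFun.odd, ap_prec_zero, ap_zero]
theorem odd_succ : ap .odd ![succ x] = ap .isZero ![ap .odd ![x]] := by
  conv_lhs => rw [PRFun.odd, ap_prec_succ, ap_comp₁, ap_proj]
  rfl
theorem half_zero : ap .half ![zero] = (zero : TmQ Γ) := by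
  rw [PRFun.half, ap_prec_zero, ap_zero]
theorem half_succ : ap .half ![succ x] = ap .add ![ap .odd ![x], ap .half ![x]] := by
  conv_lhs => rw [PRFun.half, ap_prec_succ, ap_comp₂, ap_comp₁, ap_proj, ap_proj]
  rfl
theorem halfIf_zero : ap .halfIf ![zero, y] = y := by
  rw [PRFun.halfIf, ap_prec_zero, ap_proj]; rfl
theorem halfIf_succ : ap .halfIf ![succ x, y] = ap .half ![y] := by
  rw [PRFun.halfIf, ap_prec_succ, ap_comp₁, ap_proj]; rfl
theorem strip_eq : ap .strip ![x] = ap .halfIf ![ap .odd ![x], x] := by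
  rw [PRFun.strip, ap_comp₂, ap_proj]; rfl
theorem strips_zero : ap .strips ![zero, y] = y := by
  rw [PRFun.strips, ap_prec_zero, ap_proj]; rfl
theorem strips_succ : ap .strips ![succ x, y] = ap .strip ![ap .strips ![x, y]] := by
  conv_lhs => rw [PRFun.strips, ap_prec_succ, ap_comp₁, ap_proj]
  rfl
theorem count_zero : ap .count ![zero, y] = zero := by
  rw [PRFun.count, ap_prec_zero, ap_comp₀]
theorem count_succ : ap .count ![succ x, y] =
    ap .add ![ap .count ![x, y], ap .odd ![ap .strips ![x, y]]] := by
  conv_lhs => rw [PRFun.count, ap_prec_succ, ap_comp₂, ap_comp₁, ap_comp₂, ap_proj, ap_proj, ap_proj]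
  rfl
theorem double_zero : ap .double ![zero] = (zero : TmQ Γ) := by
  rw [PRFun.double, ap_prec_zero, ap_zero]
theorem double_succ : ap .double ![succ x] = succ (succ (ap .double ![x])) := by
  conv_lhs => rw [PRFun.double, ap_prec_succ, ap_comp₁, ap_comp₁, ap_proj]
  rfl
theorem pair_zero : ap .pair ![zero, y] = ap .double ![y] := by
  rw [PRFun.pair, ap_prec_zero]
theorem pair_succ : ap .pair ![succ x, y] = succ (ap .double ![ap .pair ![x, y]]) := by
  conv_lhs => rw [PRFun.pair, ap_prec_succ, ap_comp₁, ap_comp₁, ap_proj]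
  rfl
theorem pairSub_zero : ap .pairSub ![zero, y] = ap .double ![y] := by
  rw [PRFun.pairSub, ap_prec_zero]
theorem pairSub_succ : ap .pairSub ![succ x, y] =
    ap .add ![ap .pair ![x, y], ap .pairSub ![x, y]] := by
  conv_lhs => rw [PRFun.pairSub, ap_prec_succ, ap_comp₂, ap_comp₂, ap_proj, ap_proj, ap_proj]
  rfl
theorem fst_eq : ap .fst ![x] = ap .count ![x, x] := by
  rw [PRFun.fst, ap_comp₂, ap_proj]; rfl
theorem snd_eq : ap .snd ![x] = ap .half ![ap .strips ![x, x]] := by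
  rw [PRFun.snd, ap_comp₁, ap_comp₂, ap_proj]; rfl

theorem add_zero : ap .add ![x, zero] = x := by
  simpa only [val_app₂, val_zero, val_var, cons_zero] using
    eq_induction (Tm.app .add ![Tm.v 0, Tm.zero]) (Tm.v 0)
      (fun Γ ρ => by simp only [val_app₂, val_zero, val_var, cons_zero, add_zero'])
      (fun Γ x ρ ih => by
        simp only [val_app₂, val_zero, val_var, cons_zero, add_succ'] at ih ⊢; rw [ih])
      x (fun _ => zero)

theorem add_succ : ap .add ![x, succ y] = succ (ap .add ![x, y]) := by
  simpa only [val_app₂, val_succ, val_var, cons_zero, cons_one] using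
    eq_induction (Tm.app .add ![Tm.v 0, (Tm.v 1).succ]) (Tm.app .add ![Tm.v 0, Tm.v 1]).succ
      (fun Γ ρ => by simp only [val_app₂, val_succ, val_var, cons_zero, cons_one, add_zero'])
      (fun Γ x ρ ih => by
        simp only [val_app₂, val_succ, val_var, cons_zero, cons_one, add_succ'] at ih ⊢; rw [ih])
      x (cons y fun _ => zero)

theorem add_assoc : ap .add ![ap .add ![x, y], z] = ap .add ![x, ap .add ![y, z]] := by
  simpa only [val_app₂, val_var, cons_zero, cons_one, cons_two] using
    eq_induction (Tm.app .add ![Tm.app .add ![Tm.v 0, Tm.v 1], Tm.v 2])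
      (Tm.app .add ![Tm.v 0, Tm.app .add ![Tm.v 1, Tm.v 2]])
      (fun Γ ρ => by simp only [val_app₂, val_var, cons_zero, cons_one, cons_two, add_zero'])
      (fun Γ x ρ ih => by
        simp only [val_app₂, val_var, cons_zero, cons_one, cons_two, add_succ'] at ih ⊢; rw [ih])
      x (cons y (cons z fun _ => zero))

theorem double_eq : ap .double ![x] = ap .add ![x, x] := by
  simpa only [val_app₂, val_app₁, val_var, cons_zero] using
    eq_induction (Tm.app .double ![Tm.v 0]) (Tm.app .add ![Tm.v 0, Tm.v 0])
      (fun Γ ρ => by simp only [val_app₂, val_app₁, val_var, cons_zero, add_zero', double_zero])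
      (fun Γ x ρ ih => by
        simp only [val_app₂, val_app₁, val_var, cons_zero, add_succ', add_succ, double_succ] at ih ⊢
        rw [ih])
      x (fun _ => zero)

theorem odd_double : ap .odd ![ap .double ![x]] = zero := by
  simpa only [val_app₁, val_var, cons_zero, val_zero] using
    eq_induction (Tm.app .odd ![Tm.app .double ![Tm.v 0]]) Tm.zero
      (fun Γ ρ => by simp only [val_app₁, val_var, cons_zero, val_zero, odd_zero, double_zero])
      (fun Γ x ρ ih => by
        simp only [val_app₁, val_var, cons_zero, val_zero, odd_succ, double_succ] at ih ⊢
        rw [ih, isZero_zero, isZero_succ])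
      x (fun _ => zero)

theorem odd_succ_double : ap .odd ![succ (ap .double ![x])] = succ zero := by
  rw [odd_succ, odd_double, isZero_zero]

theorem half_double : ap .half ![ap .double ![x]] = x := by
  simpa only [val_app₁, val_var, cons_zero] using
    eq_induction (Tm.app .half ![Tm.app .double ![Tm.v 0]]) (Tm.v 0)
      (fun Γ ρ => by simp only [val_app₁, val_var, cons_zero, half_zero, double_zero])
      (fun Γ x ρ ih => by
        simp only [val_app₁, val_var, cons_zero, half_succ, double_succ, odd_succ_double,
          odd_double, add_succ', add_zero'] at ih ⊢
        rw [ih])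
      x (fun _ => zero)

theorem strip_double : ap .strip ![ap .double ![x]] = ap .double ![x] := by
  rw [strip_eq, odd_double, halfIf_zero]

theorem strip_succ_double : ap .strip ![succ (ap .double ![x])] = x := by
  rw [strip_eq, odd_succ_double, halfIf_succ, half_succ, odd_double, half_double, add_zero']

/-- The defining recursion applies `strip` last, whereas decoding a pair has to apply it first. -/
theorem strips_succ' : ap .strips ![succ x, y] = ap .strips ![x, ap .strip ![y]] := by
  simpa only [val_app₂, val_app₁, val_succ, val_var, cons_zero, cons_one] using
    eq_induction (Tm.app .strips ![(Tm.v 0).succ, Tm.v 1])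
      (Tm.app .strips ![Tm.v 0, Tm.app .strip ![Tm.v 1]])
      (fun Γ ρ => by
        simp only [val_app₂, val_app₁, val_succ, val_var, cons_zero, cons_one, strips_succ, strips_zero])
      (fun Γ x ρ ih => by
        simp only [val_app₂, val_app₁, val_succ, val_var, cons_zero, cons_one] at ih ⊢
        rw [strips_succ, ih, strips_succ])
      x (cons y fun _ => zero)

theorem strips_double : ap .strips ![x, ap .double ![y]] = ap .double ![y] := by
  simpa only [val_app₂, val_app₁, val_var, cons_zero, cons_one] using
    eq_induction (Tm.app .strips ![Tm.v 0, Tm.app .double ![Tm.v 1]]) (Tm.app .double ![Tm.v 1])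
      (fun Γ ρ => by simp only [val_app₂, val_app₁, val_var, cons_zero, cons_one, strips_zero])
      (fun Γ x ρ ih => by
        simp only [val_app₂, val_app₁, val_var, cons_zero, cons_one] at ih ⊢
        rw [strips_succ, ih, strip_double])
      x (cons y fun _ => zero)

theorem count_succ' : ap .count ![succ x, y] =
    ap .add ![ap .odd ![y], ap .count ![x, ap .strip ![y]]] := by
  simpa only [val_app₂, val_app₁, val_succ, val_var, cons_zero, cons_one] using
    eq_induction (Tm.app .count ![(Tm.v 0).succ, Tm.v 1])
      (Tm.app .add ![Tm.app .odd ![Tm.v 1], Tm.app .count ![Tm.v 0, Tm.app .strip ![Tm.v 1]]])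
      (fun Γ ρ => by
        simp only [val_app₂, val_app₁, val_succ, val_var, cons_zero, cons_one, count_succ,
          count_zero, strips_zero, add_zero', add_zero])
      (fun Γ x ρ ih => by
        simp only [val_app₂, val_app₁, val_succ, val_var, cons_zero, cons_one] at ih ⊢
        rw [count_succ, ih, add_assoc, strips_succ', ← count_succ])
      x (cons y fun _ => zero)

theorem count_double : ap .count ![x, ap .double ![y]] = zero := by
  simpa only [val_app₂, val_app₁, val_zero, val_var, cons_zero, cons_one] using
    eq_induction (Tm.app .count ![Tm.v 0, Tm.app .double ![Tm.v 1]]) Tm.zero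
      (fun Γ ρ => by simp only [val_app₂, val_app₁, val_zero, val_var, cons_zero, cons_one, count_zero])
      (fun Γ x ρ ih => by
        simp only [val_app₂, val_app₁, val_zero, val_var, cons_zero, cons_one] at ih ⊢
        rw [count_succ, ih, strips_double, odd_double, add_zero])
      x (cons y fun _ => zero)

/-- Since `p(x, y) + 1 = 2^x (2y + 1)`, the binary expansion of `p(x, y)` is that of `2y` followed
by `x` ones. Stripping removes these ones and then stays at `2y`, so every number `z + x` of steps
gives the same result. -/
theorem strips_pair :
    ap .strips ![ap .add ![z, x], ap .pair ![x, y]] = ap .double ![y] := by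
  simpa only [val_app₂, val_app₁, val_var, cons_zero, cons_one, cons_two] using
    eq_induction (Tm.app .strips ![Tm.app .add ![Tm.v 2, Tm.v 0], Tm.app .pair ![Tm.v 0, Tm.v 1]])
      (Tm.app .double ![Tm.v 1])
      (fun Γ ρ => by
        simp only [val_app₂, val_app₁, val_var, cons_zero, cons_one, cons_two, pair_zero, strips_double])
      (fun Γ x ρ ih => by
        simp only [val_app₂, val_app₁, val_var, cons_zero, cons_one, cons_two] at ih ⊢
        rw [add_succ, pair_succ, strips_succ', strip_succ_double, ih])
      x (cons y (cons z fun _ => zero))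

theorem count_pair : ap .count ![ap .add ![z, x], ap .pair ![x, y]] = x := by
  simpa only [val_app₂, val_app₁, val_var, cons_zero, cons_one, cons_two] using
    eq_induction (Tm.app .count ![Tm.app .add ![Tm.v 2, Tm.v 0], Tm.app .pair ![Tm.v 0, Tm.v 1]])
      (Tm.v 0)
      (fun Γ ρ => by
        simp only [val_app₂, val_var, cons_zero, cons_one, cons_two, pair_zero, count_double])
      (fun Γ x ρ ih => by
        simp only [val_app₂, val_var, cons_zero, cons_one, cons_two] at ih ⊢
        rw [add_succ, pair_succ, count_succ', strip_succ_double, ih, odd_succ_double, add_succ',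
          add_zero'])
      x (cons y (cons z fun _ => zero))

/-- This says `x ≤ p(x, y)`: a pair is itself a sufficient number of steps for its own decoding. -/
theorem pair_eq_add : ap .pair ![x, y] = ap .add ![ap .pairSub ![x, y], x] := by
  simpa only [val_app₂, val_app₁, val_var, cons_zero, cons_one] using
    eq_induction (Tm.app .pair ![Tm.v 0, Tm.v 1])
      (Tm.app .add ![Tm.app .pairSub ![Tm.v 0, Tm.v 1], Tm.v 0])
      (fun Γ ρ => by
        simp only [val_app₂, val_var, cons_zero, cons_one, pair_zero, pairSub_zero, add_zero])
      (fun Γ x ρ ih => by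
        simp only [val_app₂, val_var, cons_zero, cons_one] at ih ⊢
        rw [pair_succ, double_eq, pairSub_succ, add_succ, add_assoc, ← ih])
      x (cons y fun _ => zero)

theorem fst_pair : ap .fst ![ap .pair ![x, y]] = x := by
  rw [fst_eq]
  nth_rw 1 [pair_eq_add]
  rw [count_pair]

theorem snd_pair : ap .snd ![ap .pair ![x, y]] = y := by
  rw [snd_eq]
  nth_rw 1 [pair_eq_add]
  rw [strips_pair, half_double]

end Equations

end TmQ

/-! ### Coding the free variables of a formula by one variable -/

/-- The `i`-th component of the sequence coded by `t`. -/
def Tm.component (t : Tm) (i : ℕ) : Tm :=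
  Tm.app .fst ![(fun s => Tm.app .snd ![s])^[i] t]

/-- The code of the sequence of the variables `m`, …, `m + n - 1`. -/
def Tm.codeVars : ℕ → ℕ → Tm
  | 0, _ => Tm.zero
  | n + 1, m => Tm.app .pair ![Tm.v m, Tm.codeVars n (m + 1)]

theorem Tm.app₁_subst (f : PRFun 1) (t : Tm) (σ : ℕ → Tm) :
    (Tm.app f ![t]).subst σ = Tm.app f ![t.subst σ] := by
  simp only [Term.subst, Term.func.injEq, heq_eq_eq, true_and]
  funext i; fin_cases i; rfl

theorem Tm.component_subst (t : Tm) (i : ℕ) (σ : ℕ → Tm) :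
    (t.component i).subst σ = Tm.component (t.subst σ) i := by
  rw [Tm.component, Tm.app₁_subst, Tm.component]
  congr 3
  induction i with
  | zero => rfl
  | succ i ih => rw [Function.iterate_succ_apply', Function.iterate_succ_apply', Tm.app₁_subst, ih]

theorem Tm.vars_component (t : Tm) (i : ℕ) : (t.component i).varFinset = t.varFinset := by
  have h : ∀ (f : PRFun 1) (s : Tm), (Tm.app f ![s]).varFinset = s.varFinset := by
    intro f s; ext; simp [Term.varFinset]
  rw [Tm.component, h]
  induction i with
  | zero => rfl
  | succ i ih => rw [Function.iterate_succ_apply', h, ih]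

theorem TmQ.mk_app₁ {Γ : List Form} (f : PRFun 1) (t : Tm) :
    (mk (Tm.app f ![t]) : TmQ Γ) = ap f ![mk t] := by
  rw [← ap_mk]; congr 1; funext i; fin_cases i; rfl

theorem TmQ.mk_app₂ {Γ : List Form} (f : PRFun 2) (s t : Tm) :
    (mk (Tm.app f ![s, t]) : TmQ Γ) = ap f ![mk s, mk t] := by
  rw [← ap_mk]; congr 1; funext i; fin_cases i <;> rfl

theorem component_codeVars {n i : ℕ} (hi : i < n) (m : ℕ) :
    Proves HA (.eq ((Tm.codeVars n m).component i) (Tm.v (m + i))) := by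
  refine TmQ.mk_eq_mk.1 ?_
  have hs : ∀ (t : Tm), (TmQ.mk ((fun s => Tm.app .snd ![s])^[i] t) : TmQ []) =
      (fun q => TmQ.ap .snd ![q])^[i] (TmQ.mk t) := by
    intro t
    clear hi
    induction i with
    | zero => rfl
    | succ i ih =>
      rw [Function.iterate_succ_apply', Function.iterate_succ_apply', TmQ.mk_app₁, ih]
  rw [Tm.component, TmQ.mk_app₁, hs]
  clear hs
  induction i generalizing n m with
  | zero =>
    cases n with
    | zero => omega
    | succ n => rw [Tm.codeVars, TmQ.mk_app₂]; exact TmQ.fst_pair _ _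
  | succ i ih =>
    cases n with
    | zero => omega
    | succ n =>
      rw [Tm.codeVars, TmQ.mk_app₂, Function.iterate_succ_apply, TmQ.snd_pair,
        ih (Nat.lt_of_succ_lt_succ hi), Nat.add_right_comm, Nat.add_assoc]

/-- The substitution which replaces every variable by a component of the variable `0`. -/
def encode (i : ℕ) : Tm := (Tm.v 0).component i

theorem fv_subst_encode (φ : Form) : (φ.subst encode).fv ⊆ {0} := by
  intro m hm
  rw [Form.mem_fv_subst] at hm
  obtain ⟨n, _, hm⟩ := hm
  simpa [encode, Tm.vars_component] using hm

section

variable {T : Set Form} (hT : ∀ φ ∈ HA, Proves T φ) {φ ψ : Form} {Γ : List Form}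

-- Substituting the code of all free variables for the single parameter turns each component back
-- into its variable, up to provable equality. Instances with one parameter thus give instances with
-- any number.
include hT in
theorem Proves.of_subst_encode (h : Proves T (φ.subst encode)) : Proves T φ := by
  obtain ⟨N, hN⟩ := φ.exists_fv_bound
  have h' := h.inst (Tm.codeVars N 0)
  rw [Form.inst, Form.subst_subst, φ.subst_congr (τ := fun i => if i < N then
    (Tm.codeVars N 0).component i else Tm.v i)
    fun n hn => by simp [hN n hn, encode, Tm.component_subst, Term.subst, Form.single]] at h'
  have := Proves.eqv_subst (T := T) (σ := fun i => if i < N then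
    (Tm.codeVars N 0).component i else Tm.v i) (τ := Tm.v) (fun i => ?_) φ
  · rw [φ.subst_id] at this
    exact this.1.app h'
  · by_cases hi : i < N
    · simp only [hi, if_true]
      have := component_codeVars hi 0
      rw [Nat.zero_add] at this
      exact Deriv.mono this hT
    · simp only [hi, if_false]; exact .eqRefl _

end

/-! ### Decidability of quantifier-free formulas -/

theorem HA.zero_ne_succ {Γ : List Form} {ψ : Form} (t : Tm) (h : Deriv HA Γ (.eq Tm.zero t.succ)) :
    Deriv HA Γ ψ :=
  .botE (.impE (.ax (HAAxiom.succ_ne_zero t)) h.eqSymm)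

theorem HA.succ_congr {Γ : List Form} {s t : Tm} (h : Deriv HA Γ (.eq s t)) :
    Deriv HA Γ (.eq s.succ t.succ) :=
  .eqApp _ fun i => by fin_cases i; exact h

theorem HA.dec_eq_vars : Proves HA (.all (.all (.or (.eq (Tm.v 1) (Tm.v 0)) (Form.neg (.eq (Tm.v 1) (Tm.v 0)))))) := by
  -- Only the outer induction hypothesis is used; the inner inductions merely distinguish zero from
  -- successors.
  refine HA.induction ?_ (HA.induction ?_ ?_)
  · refine HA.induction ?_ ?_ <;>
      simp only [Form.inst, Form.subst, Form.neg, Term.subst, Form.single, Form.stepSubst,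
        Form.up_succ, Form.up_zero, Tm.zero_subst]
    · exact .orI₁ (.eqRefl _)
    · exact .orI₂ (.impI (HA.zero_ne_succ _ .h0))
  · simp only [Form.inst, Form.subst, Form.neg, Term.subst, Form.single, Form.stepSubst,
      Form.up_succ, Form.up_zero, Tm.succ_subst]
    exact .orI₂ (.impI (.impE (.ax (HAAxiom.succ_ne_zero _)) .h0))
  · simp only [Form.shift, List.map, Form.subst, Form.neg, Term.subst, Form.stepSubst, Form.up_succ,
      Tm.succ_subst, Form.up_zero]
    refine .orE (.allE (Tm.v 0) .h1) (.orI₁ ?_) (.orI₂ (.impI ?_))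
    · exact HA.succ_congr .h0
    · exact .impE .h1 (.impE (.ax (HAAxiom.succ_inj _ _)) .h0)

theorem HA.dec_eq (s t : Tm) : Dec HA (.eq s t) :=
  HA.dec_eq_vars.of_all.of_all.subst (fun n => if n = 0 then t else s)

theorem HA.dec_of_isQF {φ : Form} (h : φ.isQF = true) : Dec HA φ :=
  HeytingArith.dec_of_isQF HA.dec_eq h

/-! ### The Friedman–Gödel–Gentzen translation -/

/-- The negative translation of a formula, with `⊥` replaced by `A`. -/
def Form.friedman : Form → Form → Form
  | .bot, A => A
  | .eq s t, A => .imp (.imp (.eq s t) A) A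
  | .and φ ψ, A => .and (φ.friedman A) (ψ.friedman A)
  | .or φ ψ, A => .imp (.imp (.or (φ.friedman A) (ψ.friedman A)) A) A
  | .imp φ ψ, A => .imp (φ.friedman A) (ψ.friedman A)
  | .all φ, A => .all (φ.friedman A.shift)
  | .ex φ, A => .imp (.imp (.ex (φ.friedman A.shift)) A) A

theorem friedman_subst (φ A : Form) (σ : ℕ → Tm) :
    (φ.friedman A).subst σ = (φ.subst σ).friedman (A.subst σ) := by
  induction φ generalizing A σ <;> simp_all [Form.friedman, Form.subst, Form.shift_subst_up]

theorem friedman_shift (φ A : Form) : (φ.friedman A).shift = φ.shift.friedman A.shift :=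
  friedman_subst _ _ _

theorem friedman_inst (φ A : Form) (t : Tm) :
    (φ.friedman A.shift).inst t = (φ.inst t).friedman A := by
  rw [Form.inst, friedman_subst]
  congr 1
  exact A.shift_inst t

section Friedman

variable {T : Set Form} {Γ : List Form}

theorem Deriv.relNeg_relNeg {φ A : Form} (h : Deriv T Γ φ) : Deriv T Γ (.imp (.imp φ A) A) :=
  .impI (.impE .h0 h.weaken₁)

/-- `=`, `∨` and `∃` are translated with a relative double negation, and a quadruple relative
negation reduces to a double one; the other connectives inherit stability from their parts. -/
theorem friedman_stable (φ A : Form) :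
    Deriv T [.imp (.imp (φ.friedman A) A) A] (φ.friedman A) := by
  have triple : ∀ A χ : Form, Deriv T [.imp (.imp (.imp (.imp χ A) A) A) A] (.imp (.imp χ A) A) :=
    fun A χ => .impI (.impE .h1 (.impI (.impE .h0 .h1)))
  induction φ generalizing A with
  | bot => exact .impE .h0 (.impI .h0)
  | eq s t => exact triple _ _
  | and φ ψ ih₁ ih₂ =>
    exact .andI ((ih₁ A).app (.impI (.impE .h1 (.impI (.impE .h1 (.andE₁ .h0))))))
      ((ih₂ A).app (.impI (.impE .h1 (.impI (.impE .h1 (.andE₂ .h0))))))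
  | or φ ψ => exact triple _ _
  | imp φ ψ ih₁ ih₂ =>
    exact .impI ((ih₂ A).app (.impI (.impE .h2 (.impI (.impE .h1 (.impE .h0 .h2))))))
  | all φ ih =>
    refine .allI ((ih A.shift).app (.impI ?_))
    exact .impE (φ := .imp (Form.all (φ.friedman A.shift)).shift A.shift) .h1
      (.impI (.impE .h1 (.allE₀ .h0)))
  | ex φ => exact triple _ _

theorem Deriv.friedman_botE {φ A : Form} (h : Deriv T Γ A) : Deriv T Γ (φ.friedman A) :=
  (friedman_stable φ A).app (.impI h.weaken₁)

/-- When the goal is a translated formula, stability allows a relative double negation to be removed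
from a premise. This serves the eliminations of `∨`, `∃` and `=`. -/
theorem Deriv.friedman_bind {φ χ A : Form} (h : Deriv T Γ (.imp (.imp φ A) A))
    (h' : Deriv T (φ :: Γ) (χ.friedman A)) : Deriv T Γ (χ.friedman A) :=
  (friedman_stable χ A).app (.impI (.impE h.weaken₁ (.impI (.impE .h1
    (h'.weaken (List.cons_subset_cons _ (List.subset_cons_self _ _)))))))

end Friedman

theorem HAAxiom.friedman {φ : Form} (h : HAAxiom φ) (A : Form) : Proves HA (φ.friedman A) := by
  cases h with
  | succ_ne_zero t =>
    exact .impI (.impE .h0 (.impI (.botE (.impE (.ax (HAAxiom.succ_ne_zero t)) .h0))))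
  | succ_inj s t =>
    exact .impI (.impI (.impE .h1 (.impI (.impE .h1 (.impE (.ax (HAAxiom.succ_inj s t)) .h0)))))
  | proj i ts => exact .relNeg_relNeg (.ax (HAAxiom.proj i ts))
  | comp f g ts => exact .relNeg_relNeg (.ax (HAAxiom.comp f g ts))
  | prec_zero f g ts => exact .relNeg_relNeg (.ax (HAAxiom.prec_zero f g ts))
  | prec_succ f g t ts => exact .relNeg_relNeg (.ax (HAAxiom.prec_succ f g t ts))
  | induction φ =>
    -- The induction variable does not occur in `A.shift`, so the translated axiom is again an
    -- induction axiom.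
    have := HAAxiom.induction (φ.friedman A.shift)
    rw [friedman_inst, friedman_subst, Form.shift_stepSubst] at this
    exact .ax this

/-- If `PA` derives a formula, then `HA` derives its translation. -/
theorem Deriv.friedman {Γ : List Form} {φ : Form} (h : Deriv PA Γ φ) (A : Form) :
    Deriv HA (Γ.map fun χ => χ.friedman A) (φ.friedman A) := by
  have hshift : ∀ (Γ : List Form) (A : Form), (Γ.map Form.shift).map (fun χ => χ.friedman A.shift) =
      (Γ.map fun χ => χ.friedman A).map Form.shift := by
    intro Γ A
    simp only [List.map_map]
    exact List.map_congr_left fun χ _ => (friedman_shift χ A).symm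
  induction h generalizing A with
  | @ax Γ φ h =>
    refine .ofProves ?_
    rcases h with h | ⟨φ, rfl⟩
    · exact HAAxiom.friedman h A
    -- The relative double negation of excluded middle is an intuitionistic theorem.
    · exact .impI (.impE .h0 (.orI₂ (.impI (.impE .h1 (.orI₁ .h0)))))
  | hyp h => exact .hyp (List.mem_map_of_mem h)
  | botE _ ih => exact .friedman_botE (ih A)
  | andI _ _ ih₁ ih₂ => exact .andI (ih₁ A) (ih₂ A)
  | andE₁ _ ih => exact .andE₁ (ih A)
  | andE₂ _ ih => exact .andE₂ (ih A)
  | orI₁ _ ih => exact .relNeg_relNeg (.orI₁ (ih A))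
  | orI₂ _ ih => exact .relNeg_relNeg (.orI₂ (ih A))
  | orE _ _ _ ih₁ ih₂ ih₃ =>
    refine .friedman_bind (ih₁ A) (.orE .h0 ?_ ?_)
    · exact (ih₂ A).weaken (List.cons_subset_cons _ (List.subset_cons_self _ _))
    · exact (ih₃ A).weaken (List.cons_subset_cons _ (List.subset_cons_self _ _))
  | impI _ ih => exact .impI (ih A)
  | impE _ _ ih₁ ih₂ => exact .impE (ih₁ A) (ih₂ A)
  | allI _ ih => exact .allI (hshift _ A ▸ ih A.shift)
  | allE t _ ih =>
    have := Deriv.allE t (ih A)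
    rwa [friedman_inst] at this
  | exI t _ ih => exact .relNeg_relNeg (.exI t (by rw [friedman_inst]; exact ih A))
  | @exE Γ φ ψ _ _ ih₁ ih₂ =>
    refine .friedman_bind (ih₁ A) (.exE .h0 ?_)
    have := ih₂ A.shift
    rw [List.map_cons, hshift, ← friedman_shift] at this
    exact this.weaken (List.cons_subset_cons _ (List.subset_cons_self _ _))
  | eqRefl t => exact .relNeg_relNeg (.eqRefl t)
  | @eqSubst Γ s t φ _ _ ih₁ ih₂ =>
    refine .friedman_bind (ih₁ A) ?_
    have := Deriv.eqSubst (φ.friedman A.shift) (.h0 (T := HA)) (ih₂ A |>.weaken₁ (ψ := .eq s t)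
      |> fun h => by rwa [← friedman_inst] at h)
    rwa [friedman_inst] at this

/-! ### Conservation -/

theorem friedman_of_isQF {φ : Form} (h : φ.isQF = true) (A : Form) :
    Deriv HA [φ] (φ.friedman A) ∧ Deriv HA [φ.friedman A, φ.neg] A := by
  induction φ with
  | bot => exact ⟨.botE .h0, .h0⟩
  | eq s t => exact ⟨.relNeg_relNeg .h0, .impE .h0 (.impI (.absurd .h2 .h0))⟩
  | and φ ψ ih₁ ih₂ =>
    simp only [Form.isQF, Bool.and_eq_true] at h
    obtain ⟨p₁, n₁⟩ := ih₁ h.1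
    obtain ⟨p₂, n₂⟩ := ih₂ h.2
    have n₁ := Deriv.impI (Deriv.impI n₁)
    have n₂ := Deriv.impI (Deriv.impI n₂)
    refine ⟨.andI (p₁.app (.andE₁ .h0)) (p₂.app (.andE₂ .h0)), ?_⟩
    refine .cases_or (HA.dec_of_isQF h.1) ?_ (.impE (.mp n₁ .h0) (.andE₁ .h1) )
    exact .impE (.mp n₂ (.impI (.impE .h3 (.andI .h1 .h0)))) (.andE₂ .h1)
  | or φ ψ ih₁ ih₂ =>
    simp only [Form.isQF, Bool.and_eq_true] at h
    obtain ⟨p₁, n₁⟩ := ih₁ h.1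
    obtain ⟨p₂, n₂⟩ := ih₂ h.2
    have n₁ := Deriv.impI (Deriv.impI n₁)
    have n₂ := Deriv.impI (Deriv.impI n₂)
    refine ⟨.relNeg_relNeg (.orE .h0 (.orI₁ (p₁.app .h0)) (.orI₂ (p₂.app .h0))), ?_⟩
    refine .impE .h0 (.impI (.orE .h0 (.impE (.mp n₁ (.impI ?_)) .h0) (.impE (.mp n₂ (.impI ?_)) .h0)))
    · exact .impE (.hyp (φ := (Form.or φ ψ).neg) (by simp)) (.orI₁ .h0)
    · exact .impE (.hyp (φ := (Form.or φ ψ).neg) (by simp)) (.orI₂ .h0)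
  | imp φ ψ ih₁ ih₂ =>
    simp only [Form.isQF, Bool.and_eq_true] at h
    obtain ⟨p₁, n₁⟩ := ih₁ h.1
    obtain ⟨p₂, n₂⟩ := ih₂ h.2
    have n₁ := Deriv.impI (Deriv.impI n₁)
    have n₂ := Deriv.impI (Deriv.impI n₂)
    refine ⟨.impI (.cases_or (HA.dec_of_isQF h.1) (p₂.app (.impE .h2 .h0))
      (.friedman_botE (.impE (.mp n₁ .h0) .h1))), ?_⟩
    refine .cases_or (HA.dec_of_isQF h.1) ?_ (.absurd .h2 (.impI (.absurd .h1 .h0)))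
    exact .impE (.mp n₂ (.impI (.impE .h3 (.impI .h1)))) (.impE .h1 (p₁.app .h0))
  | all | ex => simp [Form.isQF] at h

/-- Refuting the translation from the dual instead of from the negation provides witnesses at
universal quantifiers, so `HA` needs decidability only for the matrix. -/
theorem Pre.friedman {b : Bool} {k : ℕ} {φ : Form} (h : Pre b k φ) (A : Form) :
    Deriv HA [φ] (φ.friedman A) ∧ Proves HA (.imp φ.dual (.imp (φ.friedman A) A)) := by
  induction h generalizing A with
  | qf h =>
    rw [dual_of_isQF h]
    exact ⟨(friedman_of_isQF h A).1, .impI (.impI (friedman_of_isQF h A).2)⟩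
  | alt _ ih => exact ih A
  | @quant b k φ _ ih =>
    obtain ⟨p, n⟩ := ih A.shift
    cases b with
    | true =>
      exact ⟨.relNeg_relNeg p.ex_mono, .impI (.impI (.impE .h0 (.impI (.exE .h0
        (.impE (.mp n (.allE₀ (φ := φ.dual) .h3)) .h0)))))⟩
    | false =>
      exact ⟨p.all_mono, .impI (.impI (.exE (φ := φ.dual) .h1
        (.impE (.mp n .h0) (.allE₀ (φ := φ.friedman A.shift) .h1))))⟩

section Conservation

variable {T : Set Form} (hT : ∀ φ ∈ HA, Proves T φ)

include hT

/-- Beneath the outer existential block the formula is decidable: either it holds, or its dual does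
and refutes the translation. The outer block is absorbed by the relative double negation in the
translation of `∃`. -/
theorem Pre.of_friedman {k : ℕ} (hd : ∀ i < k, DecPre T i) {φ : Form} (h : Pre true k φ) (A : Form) :
    Proves T (.imp (φ.friedman A) (.imp (.imp φ A) A)) := by
  have base : ∀ φ b l, Pre b l φ → Dec T φ → ∀ A, (Deriv T [φ.neg] φ.dual) →
      Proves T (.imp (φ.friedman A) (.imp (.imp φ A) A)) := by
    intro φ b l hφ hdec A hdual
    refine .impI (.impI (.cases_or hdec (.impE .h1 .h0) ?_))
    exact .impE (.mp (Deriv.mono (hφ.friedman A).2 hT) (hdual.app .h0)) .h2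
  cases k with
  | zero =>
    refine base φ _ _ h (Deriv.mono (HA.dec_of_isQF h.isQF_of_zero) hT) A ?_
    rw [dual_of_isQF h.isQF_of_zero]
    exact .h0
  | succ k =>
    refine h.rec_succ (P := fun φ => ∀ A, Proves T (.imp (φ.friedman A) (.imp (.imp φ A) A)))
      (fun φ hφ A => ?_) (fun φ hφ ih A => ?_) A
    · have hk := hd k (by omega)
      exact base φ _ _ hφ (hk hφ) A (hφ.neg_imp_dual (fun i hi => hd i (by omega)) (.inr hk))
    · refine .impI (.impI (.impE .h1 (.impI (.exE .h0 ?_))))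
      refine .impE (.mp (ih A.shift) .h0) (.impI ?_)
      exact .impE (φ := (Form.ex φ).shift) .h3 (.exI₀ .h0)

/-- Implications between `Σ_k` formulas that are provable in `PA` are provable in every extension
of `HA` in which the formulas below level `k` are decidable. -/
theorem conservation {k : ℕ} (hd : ∀ i < k, DecPre T i) {φ ψ : Form} (hφ : Pre true k φ)
    (hψ : Pre true k ψ) (h : Proves PA (.imp φ ψ)) : Deriv T [φ] ψ := by
  -- With `A := ψ` the relative double negation of `ψ` is `(ψ → ψ) → ψ`, which yields `ψ`.
  have h₁ : Proves T (.imp (φ.friedman ψ) (ψ.friedman ψ)) := Deriv.mono (Deriv.friedman h ψ) hT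
  have h₂ : Deriv T [φ] (φ.friedman ψ) := Deriv.mono (hφ.friedman ψ).1 hT
  exact .impE (.mp (hψ.of_friedman hT hd ψ) (.mp h₁ h₂)) (.impI .h0)

end Conservation

/-! ### Alternation paths -/

section Alt

variable {φ ψ : Form}

theorem alt_of_isQF (h : φ.isQF = true) : φ.alt = {[]} := by
  cases φ <;> simp_all [Form.alt, Form.isQF]

theorem alt_nonempty (φ : Form) : φ.alt.Nonempty := by
  induction φ with
  | bot | eq => simp [Form.alt]
  | and φ ψ h₁ h₂ | or φ ψ h₁ h₂ =>
    rw [Form.alt]; split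
    · simp
    · exact h₁.mono Finset.subset_union_left
  | imp φ ψ h₁ h₂ =>
    rw [Form.alt]; split
    · simp
    · split
      · exact h₁.image _
      · exact (h₁.image _).mono Finset.subset_union_left
  | all φ h₁ | ex φ h₁ => exact h₁.image _

theorem alt_subst (φ : Form) (σ : ℕ → Tm) : (φ.subst σ).alt = φ.alt := by
  have hb : ∀ (ψ : Form) (σ : ℕ → Tm), (ψ.subst σ).isBot = ψ.isBot := by
    intro ψ σ; cases ψ <;> rfl
  induction φ generalizing σ <;> simp_all [Form.subst, Form.alt, Form.isQF, isQF_subst]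

theorem alt_neg (φ : Form) : φ.neg.alt = φ.alt.image flipPath := by
  rw [Form.neg, Form.alt]
  by_cases h : φ.isQF
  · simp [Form.isQF, h, alt_of_isQF h, flipPath]
  · simp [Form.isQF, h, Form.isBot]

@[simp] theorem length_flipPath (s : List Bool) : (flipPath s).length = s.length := by
  simp [flipPath]

@[simp] theorem flipPath_flipPath (s : List Bool) : flipPath (flipPath s) = s := by
  simp [flipPath, Function.comp_def]

theorem head?_flipPath (s : List Bool) (b : Bool) :
    (flipPath s).head? = some b ↔ s.head? = some !b := by
  cases s <;> cases b <;> simp [flipPath]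

theorem head?_pushSign (b : Bool) (s : List Bool) : (pushSign b s).head? = some b := by
  unfold pushSign; split <;> simp_all

theorem length_pushSign (b : Bool) (s : List Bool) :
    (pushSign b s).length = if s.head? = some b then s.length else s.length + 1 := by
  unfold pushSign; split <;> simp_all

theorem forall_alt_and {p : List Bool → Prop} (h₀ : p [])
    (h : ∀ s ∈ (Form.and φ ψ).alt, p s) : (∀ s ∈ φ.alt, p s) ∧ ∀ s ∈ ψ.alt, p s := by
  by_cases hq : (Form.and φ ψ).isQF
  · simp only [Form.isQF, Bool.and_eq_true] at hq
    simp [alt_of_isQF hq.1, alt_of_isQF hq.2, h₀]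
  · simp only [Form.alt, if_neg hq, Finset.mem_union] at h
    exact ⟨fun s hs => h s (.inl hs), fun s hs => h s (.inr hs)⟩

theorem forall_alt_or {p : List Bool → Prop} (h₀ : p [])
    (h : ∀ s ∈ (Form.or φ ψ).alt, p s) : (∀ s ∈ φ.alt, p s) ∧ ∀ s ∈ ψ.alt, p s := by
  by_cases hq : (Form.or φ ψ).isQF
  · simp only [Form.isQF, Bool.and_eq_true] at hq
    simp [alt_of_isQF hq.1, alt_of_isQF hq.2, h₀]
  · simp only [Form.alt, if_neg hq, Finset.mem_union] at h
    exact ⟨fun s hs => h s (.inl hs), fun s hs => h s (.inr hs)⟩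

/-- When `ψ` is `⊥`, its empty path may be missing from the paths of the implication; `p []` makes
up for that. -/
theorem forall_alt_imp {p : List Bool → Prop} (h₀ : p [])
    (h : ∀ s ∈ (Form.imp φ ψ).alt, p s) : (∀ s ∈ φ.alt, p (flipPath s)) ∧ ∀ s ∈ ψ.alt, p s := by
  by_cases hq : (Form.imp φ ψ).isQF
  · simp only [Form.isQF, Bool.and_eq_true] at hq
    simp [alt_of_isQF hq.1, alt_of_isQF hq.2, h₀, flipPath]
  · by_cases hb : ψ.isBot
    · have : ψ = .bot := by cases ψ <;> simp_all [Form.isBot]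
      subst this
      simp only [Form.alt, hq, hb] at h
      exact ⟨fun s hs => h _ (Finset.mem_image_of_mem _ hs), by simp [Form.alt, h₀]⟩
    · simp only [Form.alt, if_neg hq, if_neg hb, Finset.mem_union] at h
      exact ⟨fun s hs => h _ (.inl (Finset.mem_image_of_mem _ hs)), fun s hs => h s (.inr hs)⟩

theorem alt_quant (b : Bool) (φ : Form) : (Form.quant b φ).alt = φ.alt.image (pushSign b) := by
  cases b <;> rfl

/-- All alternation paths of `φ` have length at most `k`. -/
def DegLe (k : ℕ) (φ : Form) : Prop := ∀ s ∈ φ.alt, s.length ≤ k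

/-- All alternation paths of `φ` have length at most `k`, and those of length `k` start with `b`. -/
def AltLe (b : Bool) (k : ℕ) (φ : Form) : Prop :=
  ∀ s ∈ φ.alt, s.length ≤ k ∧ (s.length = k → s.head? = some b)

theorem degLe_iff {k : ℕ} : DegLe k φ ↔ φ.degree ≤ k := by
  simp [DegLe, Form.degree, Finset.sup_le_iff]

theorem AltLe.degLe {b : Bool} {k : ℕ} (h : AltLe b k φ) : DegLe k φ := fun s hs => (h s hs).1

theorem AltLe.and {b : Bool} {k : ℕ} (h : AltLe b (k + 1) (.and φ ψ)) :
    AltLe b (k + 1) φ ∧ AltLe b (k + 1) ψ := forall_alt_and (by simp) h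

theorem AltLe.or {b : Bool} {k : ℕ} (h : AltLe b (k + 1) (.or φ ψ)) :
    AltLe b (k + 1) φ ∧ AltLe b (k + 1) ψ := forall_alt_or (by simp) h

theorem AltLe.imp {b : Bool} {k : ℕ} (h : AltLe b (k + 1) (.imp φ ψ)) :
    AltLe (!b) (k + 1) φ ∧ AltLe b (k + 1) ψ := by
  obtain ⟨h₁, h₂⟩ := forall_alt_imp (p := fun s => s.length ≤ k + 1 ∧
    (s.length = k + 1 → s.head? = some b)) (by simp) h
  refine ⟨fun s hs => ?_, h₂⟩
  have := h₁ s hs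
  rwa [length_flipPath, head?_flipPath] at this

theorem DegLe.and {k : ℕ} (h : DegLe k (.and φ ψ)) : DegLe k φ ∧ DegLe k ψ :=
  forall_alt_and (by simp) h

theorem DegLe.or {k : ℕ} (h : DegLe k (.or φ ψ)) : DegLe k φ ∧ DegLe k ψ :=
  forall_alt_or (by simp) h

theorem DegLe.imp {k : ℕ} (h : DegLe k (.imp φ ψ)) : DegLe k φ ∧ DegLe k ψ := by
  obtain ⟨h₁, h₂⟩ := forall_alt_imp (p := fun s => s.length ≤ k) (by simp) h
  exact ⟨fun s hs => length_flipPath s ▸ h₁ s hs, h₂⟩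

theorem DegLe.quant {b : Bool} {k : ℕ} (h : DegLe k (Form.quant b φ)) :
    DegLe k φ ∧ AltLe b k (Form.quant b φ) := by
  refine ⟨fun s hs => ?_, fun s hs => ⟨h s hs, fun _ => ?_⟩⟩
  · have := h _ (alt_quant b φ ▸ Finset.mem_image_of_mem _ hs)
    rw [length_pushSign] at this
    split at this <;> omega
  · rw [alt_quant, Finset.mem_image] at hs
    obtain ⟨t, _, rfl⟩ := hs
    exact head?_pushSign b t

theorem AltLe.of_quant {b : Bool} {k : ℕ} (h : AltLe b k (Form.quant b φ)) : AltLe b k φ := by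
  intro s hs
  have := (h _ (alt_quant b φ ▸ Finset.mem_image_of_mem _ hs)).1
  rw [length_pushSign] at this
  split at this
  · exact ⟨this, fun _ => by assumption⟩
  · exact ⟨by omega, fun h => by omega⟩

/-- Every path of the quantified formula starts with `b`, so none can be of the maximal length
reserved for the opposite sign. -/
theorem AltLe.degLe_of_quant {b : Bool} {k : ℕ} (h : AltLe (!b) (k + 1) (Form.quant b φ)) :
    DegLe k (Form.quant b φ) := by
  intro s hs
  have h := h s hs
  rw [alt_quant, Finset.mem_image] at hs
  obtain ⟨t, _, rfl⟩ := hs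
  rw [head?_pushSign] at h
  have : (pushSign b t).length ≠ k + 1 := fun e => by have := h.2 e; cases b <;> simp at this
  omega

theorem not_degLe_zero_quant (b : Bool) (φ : Form) : ¬ DegLe 0 (Form.quant b φ) := by
  intro h
  obtain ⟨s, hs⟩ := alt_nonempty φ
  have := h _ (alt_quant b φ ▸ Finset.mem_image_of_mem _ hs)
  have h' := head?_pushSign b s
  rw [List.length_eq_zero_iff.1 (Nat.le_zero.1 this)] at h'
  simp at h'

theorem DegLe.isQF (h : DegLe 0 φ) : φ.isQF = true := by
  induction φ with
  | bot | eq => rfl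
  | and φ ψ ih₁ ih₂ => simp [Form.isQF, ih₁ h.and.1, ih₂ h.and.2]
  | or φ ψ ih₁ ih₂ => simp [Form.isQF, ih₁ h.or.1, ih₂ h.or.2]
  | imp φ ψ ih₁ ih₂ => simp [Form.isQF, ih₁ h.imp.1, ih₂ h.imp.2]
  | all φ => exact absurd h (not_degLe_zero_quant false φ)
  | ex φ => exact absurd h (not_degLe_zero_quant true φ)

theorem Pre.altLe {b : Bool} {k : ℕ} (h : Pre b k φ) :
    ∀ s ∈ φ.alt, s.length ≤ k ∧ (s.length = k → k ≠ 0 → s.head? = some b) := by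
  induction h with
  | qf h => simp only [alt_of_isQF h, Finset.mem_singleton]; rintro s rfl; simp; omega
  | alt _ ih => exact fun s hs => ⟨by have := (ih s hs).1; omega, fun e => by have := (ih s hs).1; omega⟩
  | @quant b k φ _ ih =>
    intro s hs
    rw [alt_quant, Finset.mem_image] at hs
    obtain ⟨t, ht, rfl⟩ := hs
    refine ⟨?_, fun _ _ => head?_pushSign b t⟩
    have := ih t ht
    rw [length_pushSign]
    split
    · exact this.1
    · have : t.length ≠ k + 1 := fun e => by have := this.2 e; simp_all
      omega

theorem EC_of_head (h : ∀ s ∈ φ.alt, s.head? = some true) : φ ∈ EC φ.degree := by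
  cases hd : φ.degree with
  | zero => exact hd
  | succ k => exact ⟨hd, fun s hs _ => h s hs⟩

theorem altLe_of_mem_EC {k : ℕ} (h : φ ∈ EC (k + 1)) : AltLe true (k + 1) φ :=
  fun s hs => ⟨degLe_iff.2 (le_of_eq h.1) s hs, h.2 s hs⟩

theorem mem_UPlus_zero : φ ∈ UPlus 0 ↔ φ.degree = 0 := by
  simp [UPlus, UC, FC]

theorem mem_UPlus_succ {k : ℕ} : φ ∈ UPlus (k + 1) ↔ AltLe false (k + 1) φ := by
  simp only [UPlus, UC, FC, Set.mem_union, Set.mem_ofPred_eq, Set.mem_iUnion, exists_prop]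
  constructor
  · rintro (h | ⟨i, hi, h⟩) s hs
    · exact ⟨degLe_iff.2 (le_of_eq h.1) s hs, h.2 s hs⟩
    · have := degLe_iff.2 (le_of_eq h) s hs
      exact ⟨by omega, fun e => by omega⟩
  · intro h
    rcases (degLe_iff.1 h.degLe).lt_or_eq with hd | hd
    · exact .inr ⟨_, hd, rfl⟩
    · exact .inl ⟨hd, fun s hs => (h s hs).2⟩

theorem UPlus_mono {i k : ℕ} (hi : i ≤ k) (h : φ ∈ UPlus i) : φ ∈ UPlus k := by
  rcases hi.lt_or_eq with hi | rfl
  · refine Or.inr (Set.mem_iUnion₂.2 ⟨φ.degree, ?_, rfl⟩)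
    cases i with
    | zero => rw [mem_UPlus_zero.1 h]; exact hi
    | succ i => exact (degLe_iff.1 (mem_UPlus_succ.1 h).degLe).trans_lt hi
  · exact h

theorem subst_mem_UPlus {k : ℕ} (h : φ ∈ UPlus k) (σ : ℕ → Tm) : φ.subst σ ∈ UPlus k := by
  cases k with
  | zero => simpa [mem_UPlus_zero, Form.degree, alt_subst] using h
  | succ k => simpa [mem_UPlus_succ, AltLe, alt_subst] using h

end Alt

/-! ### Schemata with arbitrary parameters -/

section Schemata

variable {T : Set Form} (hT : ∀ φ ∈ HA, Proves T φ) {φ ψ : Form}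

include hT

theorem LEM.dec {b : Bool} {k : ℕ} (h : ProvesAll T (LEM (prenexClass b k))) (hφ : φ ∈ prenexClass b k) :
    Dec T φ :=
  Proves.of_subst_encode hT (h _ ⟨φ.subst encode, subst_mem_prenexClass hφ _, fv_subst_encode φ, rfl⟩).of_all

theorem DNE.stable {b : Bool} {k : ℕ} (h : ProvesAll T (DNE (prenexClass b k)))
    (hφ : φ ∈ prenexClass b k) : Deriv T [φ.neg.neg] φ :=
  .mp (Proves.of_subst_encode (φ := .imp φ.neg.neg φ) hT
    (h _ ⟨φ.subst encode, subst_mem_prenexClass hφ _, fv_subst_encode φ, rfl⟩).of_all) .h0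

theorem DNS.shift {k : ℕ} (h : ProvesAll T (DNS (UPlus k))) (hφ : φ ∈ UPlus k) :
    Deriv T [.all φ.neg.neg] (Form.all φ).neg.neg := by
  refine .mp (Proves.of_subst_encode (φ := .imp (.all φ.neg.neg) (Form.all φ).neg.neg) hT
    -- `up encode` leaves the quantified variable alone and codes only the parameters.
    (h _ ⟨φ.subst (Form.up encode), subst_mem_UPlus hφ _, ?_, rfl⟩).of_all) .h0
  rintro (_ | n) hn
  · simp
  · have : n ∈ ((Form.all φ).subst encode).fv := hn
    simpa using fv_subst_encode _ this

end Schemata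

/-! ### Decidability from double negation elimination -/

section Decidability

variable {T : Set Form} (hT : ∀ φ ∈ HA, Proves T φ) {φ ψ : Form} {j : ℕ}

include hT

theorem Pre.of_neg_dual (hd : ∀ i < j, DecPre T i) (h : Pre false j φ) : Deriv T [φ.dual.neg] φ := by
  cases j with
  | zero =>
    rw [dual_of_isQF h.isQF_of_zero]
    exact Dec.stable (Deriv.mono (HA.dec_of_isQF h.isQF_of_zero) hT)
  | succ j =>
    refine h.rec_succ (P := fun φ => Deriv T [φ.dual.neg] φ) (fun φ hφ => ?_) (fun φ _ ih => ?_)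
    · refine .cases_or (hd j (by omega) hφ) .h0 (.absurd .h1 (.app ?_ .h0))
      exact hφ.neg_imp_dual (fun i hi => hd i (by omega)) (.inl rfl)
    · exact .allI (ih.app (.impI (.impE (φ := (Form.ex φ.dual).shift) .h1 (.exI₀ .h0))))

theorem HasPre.or_dual (hd : ∀ i < j, DecPre T i) (h : Pre true j φ) (h' : Pre false j ψ) :
    HasPre T true (j + 1) (.or φ ψ) := by
  cases j with
  | zero => exact (Pre.qf (by simp [Form.isQF, h.isQF_of_zero, h'.isQF_of_zero])).hasPre
  | succ j =>
    refine h.rec_succ (P := fun φ => ∀ ψ, Pre false (j + 1) ψ → HasPre T true (j + 2) (.or φ ψ))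
      (fun φ hφ ψ hψ => ?_) (fun φ _ ih ψ hψ => ?_) ψ h'
    · have hj := hd j (by omega)
      refine HasPre.of_lt (k := j + 1) (b := false) (HasPre.congr (ψ := .neg (.and φ.dual ψ.dual))
        ?_ ?_ ⟨?_, ?_⟩) (by omega) _
      · exact (HasPre.and hd (hφ.dual.of_lt (by omega) _).hasPre hψ.dual.hasPre).neg hd (.inl rfl)
      · rw [fv_neg]; simp [Form.fv, fv_dual]
      · exact .impI (.orE .h1 (.dual_absurd (.andE₁ .h1) .h0) (.dual_absurd (.andE₂ .h1) .h0))
      · refine .cases_or (hj hφ) (.orI₁ .h0) (.orI₂ ((hψ.of_neg_dual hT hd).app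
          (.impI (.impE .h2 (.andI ?_ .h0)))))
        exact (hφ.neg_imp_dual (fun i hi => hd i (by omega)) (.inr hj)).app .h1
    · refine (ih ψ.shift (hψ.subst _)).quant.congr ?_ (Eqv.or_ex_left φ ψ)
      ext n; simp [Form.fv, Form.quant]

/-- Decidability at level `j` from double negation elimination at level `j + 1`. -/
theorem DecPre.of_dne (hd : ∀ i < j, DecPre T i)
    (hdne : ∀ φ, Pre true (j + 1) φ → Deriv T [φ.neg.neg] φ) : DecPre T j := by
  have hs : ∀ φ, Pre true j φ → Dec T φ := by
    intro φ h
    -- The double negation of `φ ∨ φᵈ` is provable because `¬φ` implies `φᵈ`, and `χ` is a Σ_{j+1}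
    -- form to which elimination applies.
    obtain ⟨χ, hχ, _, he⟩ := HasPre.or_dual hT hd h h.dual
    have hor : Proves T (.or φ φ.dual) := by
      refine he.2.app ((hdne χ hχ).app (.impI (.impE .h0 (he.1.app (.orI₂ ?_)))))
      exact (h.neg_imp_dual hd (.inl rfl)).app (.impI (.impE .h1 (he.1.app (.orI₁ .h0))))
    exact .orE hor (.orI₁ .h0) (.orI₂ ((dual_imp_neg φ).app .h0))
  intro b φ h
  cases b with
  | true => exact hs φ h
  | false =>
    exact .orE (hs _ h.dual) (.orI₂ ((dual_imp_neg φ).app .h0)) (.orI₁ ((h.of_neg_dual hT hd).app .h0))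

omit hT in
/-- Decidability at level `j` from double negation elimination and decidability of `Π_j`. -/
theorem DecPre.of_dne_of_lem (hd : ∀ i < j, DecPre T i)
    (hdne : ∀ φ, Pre true j φ → Deriv T [φ.neg.neg] φ) (hlem : ∀ φ, Pre false j φ → Dec T φ) :
    DecPre T j := by
  intro b φ h
  cases b with
  | false => exact hlem φ h
  | true =>
    refine .orE (hlem _ h.dual) (.orI₂ ((dual_imp_neg φ).app .h0)) (.orI₁ ((hdne φ h).app (.impI ?_)))
    exact .impE .h1 ((h.neg_imp_dual hd (.inl rfl)).app .h0)

end Decidability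

/-! ### Prenex normal forms -/

section Normalization

variable {T : Set Form} {φ ψ : Form} {j : ℕ}

theorem HasPre.stable (hdne : ∀ φ, Pre true j φ → Deriv T [φ.neg.neg] φ) (h : HasPre T true j φ) :
    Deriv T [φ.neg.neg] φ := by
  obtain ⟨χ, hχ, _, he⟩ := h
  exact he.2.app ((hdne χ hχ).app (he.neg.neg.1.app .h0))

section Connectives

variable (hd : ∀ i < j, DecPre T i) (hdne : ∀ φ, Pre true j φ → Deriv T [φ.neg.neg] φ)

include hd

theorem HasPre.neg_or (h : HasPre T true j φ.neg) (h' : HasPre T true j ψ.neg) :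
    HasPre T true j (Form.or φ ψ).neg :=
  (HasPre.and hd h h').congr (by simp [Form.fv, Form.neg])
    ⟨.andI (.impI (.impE .h1 (.orI₁ .h0))) (.impI (.impE .h1 (.orI₂ .h0))),
      .impI (.orE .h0 (.impE (.andE₁ .h2) .h0) (.impE (.andE₂ .h2) .h0))⟩

include hdne

/-- The classical direction is provable under a double negation, which can be removed since the
disjunction has a Σ_j form. The same device proves `HasPre.imp`. -/
theorem HasPre.neg_and (h : HasPre T true j φ.neg) (h' : HasPre T true j ψ.neg) :
    HasPre T true j (Form.and φ ψ).neg := by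
  have ho := HasPre.or hd h h'
  refine ho.congr (by simp [Form.fv, Form.neg]) ⟨(ho.stable hdne).app (.impI ?_), ?_⟩
  · exact .impE .h0 (.orI₁ (.impI (.impE .h1 (.orI₂ (.impI (.impE .h3 (.andI .h1 .h0)))))))
  · exact .impI (.orE .h1 (.impE .h0 (.andE₁ .h1)) (.impE .h0 (.andE₂ .h1)))

theorem HasPre.imp (h : HasPre T true j φ.neg) (h' : HasPre T true j ψ) :
    HasPre T true j (Form.imp φ ψ) := by
  have ho := HasPre.or hd h h'
  refine ho.congr (by simp [Form.fv, Form.neg]) ⟨(ho.stable hdne).app (.impI ?_), ?_⟩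
  · exact .impE .h0 (.orI₁ (.impI (.impE .h1 (.orI₂ (.impE .h2 .h0)))))
  · exact .impI (.orE .h1 (.absurd .h0 .h1) .h0)

theorem HasPre.neg_imp (h : HasPre T true j φ) (h' : HasPre T true j ψ.neg) :
    HasPre T true j (Form.imp φ ψ).neg := by
  refine (HasPre.and hd h h').congr (by simp [Form.fv, Form.neg]) ⟨.andI ?_ ?_, ?_⟩
  · exact (h.stable hdne).app (.impI (.impE .h1 (.impI (.absurd .h1 .h0))))
  · exact .impI (.impE .h1 (.impI .h1))
  · exact .impI (.impE (.andE₂ .h1) (.impE .h0 (.andE₁ .h1)))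

end Connectives

variable {k : ℕ} (hdne : ∀ φ, Pre true k φ → Deriv T [φ.neg.neg] φ)
  (hdns : ∀ φ ∈ UPlus k, Deriv T [.all φ.neg.neg] (Form.all φ).neg.neg)
  (hd : ∀ i < k, DecPre T i)

include hdne hdns hd

theorem hasPre_of_altLe {i : ℕ} (hi : i + 1 ≤ k)
    (hlow : ∀ φ, DegLe i φ → HasPre T true (i + 1) φ ∧ HasPre T true (i + 1) φ.neg) (φ : Form) :
    (AltLe true (i + 1) φ → HasPre T true (i + 1) φ) ∧
      (AltLe false (i + 1) φ → HasPre T true (i + 1) φ.neg) := by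
  have hd' : ∀ l < i + 1, DecPre T l := fun l hl => hd l (by omega)
  have hdne' : ∀ φ, Pre true (i + 1) φ → Deriv T [φ.neg.neg] φ := fun φ hφ => hdne φ (hφ.mono hi)
  induction φ with
  | bot => exact ⟨fun _ => (Pre.qf rfl).hasPre, fun _ => (Pre.qf rfl).hasPre⟩
  | eq s t => exact ⟨fun _ => (Pre.qf rfl).hasPre, fun _ => (Pre.qf rfl).hasPre⟩
  | and φ ψ ih₁ ih₂ =>
    exact ⟨fun h => .and hd' (ih₁.1 h.and.1) (ih₂.1 h.and.2),
      fun h => .neg_and hd' hdne' (ih₁.2 h.and.1) (ih₂.2 h.and.2)⟩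
  | or φ ψ ih₁ ih₂ =>
    exact ⟨fun h => .or hd' (ih₁.1 h.or.1) (ih₂.1 h.or.2),
      fun h => .neg_or hd' (ih₁.2 h.or.1) (ih₂.2 h.or.2)⟩
  | imp φ ψ ih₁ ih₂ =>
    exact ⟨fun h => .imp hd' hdne' (ih₁.2 h.imp.1) (ih₂.1 h.imp.2),
      fun h => .neg_imp hd' hdne' (ih₁.1 h.imp.1) (ih₂.2 h.imp.2)⟩
  | all φ ih =>
    refine ⟨fun h => (hlow _ (AltLe.degLe_of_quant (b := false) h)).1, fun h => ?_⟩
    have hφ : AltLe false (i + 1) φ := AltLe.of_quant (b := false) h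
    have he : HasPre T true (i + 1) (.ex φ.neg) := (ih.2 hφ).quant
    -- The only use of DNS: if `∃x ¬φ` fails then `∀x ¬¬φ`, hence `¬¬∀x φ`, against `¬∀x φ`. So
    -- `¬¬∃x ¬φ`, and stability of the Σ form concludes.
    have hs := hdns φ (UPlus_mono hi (mem_UPlus_succ.2 hφ))
    refine he.congr (by simp [Form.fv, Form.neg]) ⟨(he.stable hdne').app (.impI ?_), ?_⟩
    · refine .impE (hs.app (.allI (.impI ?_))) .h1
      exact .impE (φ := (Form.ex φ.neg).shift) .h1 (.exI₀ .h0)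
    · exact .impI (.exE (φ := φ.neg) .h1 (.impE .h0 (.allE₀ .h1)))
  | ex φ ih =>
    refine ⟨fun h => ?_, fun h => (hlow _ (AltLe.degLe_of_quant (b := true) h)).2⟩
    exact (ih.1 (AltLe.of_quant (b := true) h)).quant

-- One spare level makes the sign irrelevant. In the universal case the level below puts `¬∀x φ` in
-- Σ_{i+1}, so `¬¬∀x φ` is Π_{i+1}; and `∀x φ` is stable because its body has a Σ_{i+2} form.
omit hdns in
theorem hasPre_of_degLe {i : ℕ} (hi : i + 2 ≤ k)
    (hlow : ∀ φ, (AltLe true (i + 1) φ → HasPre T true (i + 1) φ) ∧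
      (AltLe false (i + 1) φ → HasPre T true (i + 1) φ.neg)) (φ : Form) (h : DegLe (i + 1) φ) :
    HasPre T true (i + 2) φ ∧ HasPre T true (i + 2) φ.neg := by
  have hd' : ∀ l < i + 2, DecPre T l := fun l hl => hd l (by omega)
  have hdne' : ∀ φ, Pre true (i + 2) φ → Deriv T [φ.neg.neg] φ := fun φ hφ => hdne φ (hφ.mono hi)
  have hn : ∀ {φ}, HasPre T true (i + 1) φ → HasPre T true (i + 2) φ.neg := fun h =>
    (h.neg (fun l hl => hd l (by omega)) (.inl rfl)).of_lt (by omega) _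
  induction φ with
  | bot => exact ⟨(Pre.qf rfl).hasPre, (Pre.qf rfl).hasPre⟩
  | eq s t => exact ⟨(Pre.qf rfl).hasPre, (Pre.qf rfl).hasPre⟩
  | and φ ψ ih₁ ih₂ =>
    exact ⟨.and hd' (ih₁ h.and.1).1 (ih₂ h.and.2).1,
      .neg_and hd' hdne' (ih₁ h.and.1).2 (ih₂ h.and.2).2⟩
  | or φ ψ ih₁ ih₂ =>
    exact ⟨.or hd' (ih₁ h.or.1).1 (ih₂ h.or.2).1, .neg_or hd' (ih₁ h.or.1).2 (ih₂ h.or.2).2⟩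
  | imp φ ψ ih₁ ih₂ =>
    exact ⟨.imp hd' hdne' (ih₁ h.imp.1).2 (ih₂ h.imp.2).1,
      .neg_imp hd' hdne' (ih₁ h.imp.1).1 (ih₂ h.imp.2).2⟩
  | all φ ih =>
    obtain ⟨h₁, h₂⟩ := DegLe.quant (b := false) h
    have hneg := (hlow _).2 h₂
    refine ⟨(hn hneg).congr (by simp [Form.fv, Form.quant, Form.neg]) ⟨.impI (.impE .h0 .h1), ?_⟩,
      hneg.of_lt (by omega) _⟩
    refine .allI (((ih h₁).1.stable hdne').app (.impI ?_))
    exact .impE (φ := (Form.all φ).neg.shift) .h1 (.impI (.impE .h1 (.allE₀ .h0)))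
  | ex φ ih =>
    have hex := (hlow _).1 (DegLe.quant (b := true) h).2
    exact ⟨hex.of_lt (by omega) _, hn hex⟩

theorem hasPre_levels (i : ℕ) (hi : i + 1 ≤ k) (φ : Form) :
    (AltLe true (i + 1) φ → HasPre T true (i + 1) φ) ∧
      (AltLe false (i + 1) φ → HasPre T true (i + 1) φ.neg) := by
  induction i generalizing φ with
  | zero =>
    refine hasPre_of_altLe hdne hdns hd hi (fun φ h => ?_) φ
    exact ⟨(Pre.qf h.isQF).hasPre, (Pre.qf (by rw [isQF_neg]; exact h.isQF)).hasPre⟩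
  | succ i ih =>
    exact hasPre_of_altLe hdne hdns hd hi
      (hasPre_of_degLe hdne hd hi (ih (by omega))) φ

end Normalization

/-! ### Logical principles from prenex normal forms -/

section Converse

variable {T : Set Form} (hT : ∀ φ ∈ HA, Proves T φ) {k : ℕ} (hupper : Extends T PA)
  (hP : ∀ k' : ℕ, k' ≤ k → PNFT T (EC k') (SigmaC k'))

theorem PA.dec (φ : Form) : Dec PA φ := .ax (.inr ⟨φ, rfl⟩)

include hT hupper hP

/-- `PA` extends `T` and so proves the equivalences with the normal forms. The implication passes to
these, descends to `T` by conservation, and is carried back. -/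
theorem entails_of_PNFT {j : ℕ} (hj : j ≤ k) (hd : ∀ i < j, DecPre T i) {φ ψ : Form}
    (hφ : ∀ s ∈ φ.alt, s.head? = some true) (hψ : ∀ s ∈ ψ.alt, s.head? = some true)
    (hφ' : DegLe j φ) (hψ' : DegLe j ψ) (h : Deriv PA [φ] ψ) : Deriv T [φ] ψ := by
  rw [degLe_iff] at hφ' hψ'
  obtain ⟨φ', h₁, _, e₁⟩ := hP _ (hφ'.trans hj) φ (EC_of_head hφ)
  obtain ⟨ψ', h₂, _, e₂⟩ := hP _ (hψ'.trans hj) ψ (EC_of_head hψ)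
  have a₁ := eqv_iff_proves.2 (hupper _ e₁)
  have a₂ := eqv_iff_proves.2 (hupper _ e₂)
  have hc := conservation hT hd ((pre_of_mem_prenexClass (b := true) h₁).mono hφ')
    ((pre_of_mem_prenexClass (b := true) h₂).mono hψ')
    (.impI (a₂.1.app (h.app (a₁.2.app .h0))))
  exact (eqv_iff_proves.2 e₂).2.app (hc.app ((eqv_iff_proves.2 e₁).1.app .h0))

theorem dne_of_PNFT {j : ℕ} (hj : j ≤ k) (hd : ∀ i < j, DecPre T i) {φ : Form}
    (h : φ ∈ SigmaC j) : Deriv T [φ.neg.neg] φ := by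
  have hpre : Pre true j φ := pre_of_mem_prenexClass (b := true) h
  cases j with
  | zero => exact Dec.stable (Deriv.mono (HA.dec_of_isQF hpre.isQF_of_zero) hT)
  | succ j =>
    have hφ : ∀ s ∈ φ.alt, s.head? = some true := by
      obtain ⟨n, ψ, _, rfl⟩ := (mem_prenexClass_succ (b := true)).1 h
      rw [Function.iterate_succ_apply', alt_quant]
      intro s hs
      obtain ⟨t, _, rfl⟩ := Finset.mem_image.1 hs
      exact head?_pushSign _ _
    -- A double negation does not change the paths, so `¬¬φ` has a normal form of the same level as
    -- `φ`.
    have hnn : φ.neg.neg.alt = φ.alt := by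
      have : flipPath ∘ flipPath = id := funext flipPath_flipPath
      rw [alt_neg, alt_neg, Finset.image_image, this, Finset.image_id]
    have hdeg : DegLe (j + 1) φ := fun s hs => (hpre.altLe s hs).1
    exact entails_of_PNFT hT hupper hP hj hd (by rwa [hnn]) hφ (by rwa [DegLe, hnn]) hdeg
      (PA.dec φ).stable

theorem dne_pre_of_PNFT {j : ℕ} (hj : j ≤ k) (hd : ∀ i < j, DecPre T i) {φ : Form}
    (h : Pre true j φ) : Deriv T [φ.neg.neg] φ := by
  obtain ⟨φ', h', _, he⟩ := h.exists_prenexClass (T := T)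
  exact he.2.app ((dne_of_PNFT hT hupper hP hj hd h').app (he.neg.neg.1.app .h0))

/-- Conservation at level `i` uses decidability only below `i` and yields Σ_i-DNE; together with
Π_i-LEM this decides level `i`. -/
theorem decPre_of_PNFT (hlem : ∀ i < k, ∀ φ, Pre false i φ → Dec T φ) (i : ℕ) (hi : i < k) :
    DecPre T i := by
  induction i using Nat.strong_induction_on with
  | _ i ih =>
    have hd : ∀ l < i, DecPre T l := fun l hl => ih l hl (by omega)
    exact .of_dne_of_lem hd (fun φ h => dne_pre_of_PNFT hT hupper hP hi.le hd h) (hlem i hi)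

theorem dns_of_PNFT (hd : ∀ i < k, DecPre T i) {φ : Form} (h : φ ∈ UPlus k) :
    Deriv T [.all φ.neg.neg] (Form.all φ).neg.neg := by
  cases k with
  | zero =>
    have hq : φ.isQF = true := DegLe.isQF (degLe_iff.2 (mem_UPlus_zero.1 h).le)
    have := Dec.stable (Deriv.mono (HA.dec_of_isQF hq) hT)
    exact .impI (.impE .h0 (this.all_mono.app .h1))
  | succ k =>
    have hall : AltLe false (k + 1) (.all φ) := by
      intro s hs
      obtain ⟨t, ht, rfl⟩ := Finset.mem_image.1 hs
      refine ⟨?_, fun _ => head?_pushSign _ _⟩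
      have := mem_UPlus_succ.1 h t ht
      rw [length_pushSign]
      split
      · exact this.1
      · have : t.length ≠ k + 1 := fun e => by simp_all
        omega
    have hex : (Form.ex φ.neg).alt = (Form.all φ).neg.alt := by
      rw [alt_neg, Form.alt, Form.alt, alt_neg, Finset.image_image, Finset.image_image]
      refine Finset.image_congr fun s _ => ?_
      simp only [Function.comp_apply, pushSign, head?_flipPath, Bool.not_true]
      split <;> simp [flipPath]
    have hhead : ∀ s ∈ (Form.all φ).neg.alt, s.head? = some true := by
      rw [alt_neg]
      intro s hs
      obtain ⟨t, ht, rfl⟩ := Finset.mem_image.1 hs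
      obtain ⟨u, _, rfl⟩ := Finset.mem_image.1 ht
      rw [head?_flipPath]
      exact head?_pushSign _ _
    have hdeg : DegLe (k + 1) (Form.all φ).neg := by
      rw [DegLe, alt_neg]
      intro s hs
      obtain ⟨t, ht, rfl⟩ := Finset.mem_image.1 hs
      rw [length_flipPath]
      exact (hall t ht).1
    -- Both sides have the same paths, all starting with `+`, so this classical implication descends
    -- to `T`. DNS is immediate from it.
    have key : Deriv T [(Form.all φ).neg] (.ex φ.neg) := by
      refine entails_of_PNFT hT hupper hP le_rfl hd hhead (by rwa [hex]) hdeg (by rwa [DegLe, hex]) ?_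
      refine .cases_or (PA.dec (.ex φ.neg)) .h0 (.absurd .h1 (.allI ?_))
      exact .cases_or (PA.dec φ) .h0 (.absurd (φ := (Form.ex φ.neg).shift) .h1 (.exI₀ .h0))
    exact .impI (.exE (key.app .h0) (.impE (.allE₀ (φ := φ.neg.neg) .h2) .h0))

end Converse

-- Proof of the equivalence

theorem proves_HA_of_extends {k : ℕ} {T : Set Form} (h : Extends (HAPiLEM k) T) :
    ∀ φ ∈ HA, Proves T φ := by
  intro φ hφ
  refine h φ (.ax ?_)
  cases k
  · exact hφ
  · exact .inl hφ

end HeytingArith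

theorem mainTheorem5 (k : ℕ) (T : Set HeytingArith.Form)
    (hlower : HeytingArith.Extends (HeytingArith.HAPiLEM k) T)
    (hupper : HeytingArith.Extends T HeytingArith.PA) :
    (HeytingArith.ProvesAll T (HeytingArith.DNE (HeytingArith.SigmaC k)) ∧
      HeytingArith.ProvesAll T (HeytingArith.DNS (HeytingArith.UPlus k))) ↔
    ∀ k' : ℕ, k' ≤ k →
      HeytingArith.PNFT T (HeytingArith.EC k') (HeytingArith.SigmaC k') := by
  open HeytingArith in
  have hT := proves_HA_of_extends hlower
  constructor
  · rintro ⟨hdne, hdns⟩ k' hk' φ hφ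
    have hdne' : ∀ φ, Pre true k φ → Deriv T [φ.neg.neg] φ := by
      intro φ h
      obtain ⟨φ', h', _, he⟩ := h.exists_prenexClass (T := T)
      exact he.2.app ((DNE.stable hT (b := true) hdne h').app (he.neg.neg.1.app .h0))
    have hd : ∀ i < k, DecPre T i := by
      intro i
      induction i using Nat.strong_induction_on with
      | _ i ih =>
        exact fun hi => .of_dne hT (fun l hl => ih l hl (by omega)) fun φ h => hdne' φ (h.mono hi)
    cases k' with
    | zero => exact ⟨φ, DegLe.isQF (degLe_iff.2 (le_of_eq hφ)), rfl, eqv_iff_proves.1 (.refl φ)⟩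
    | succ i =>
      obtain ⟨φ', h', hf, he⟩ := (hasPre_levels hdne' (fun φ h => DNS.shift hT hdns h) hd i hk' φ).1
        (altLe_of_mem_EC hφ)
      obtain ⟨φ'', h'', hf', he'⟩ := h'.exists_prenexClass (T := T)
      exact ⟨φ'', h'', hf.trans hf', eqv_iff_proves.1 (he.trans he')⟩
  · intro hP
    have hlem : ∀ i < k, ∀ φ, Pre false i φ → Dec T φ := by
      intro i hi φ h
      cases k with
      | zero => omega
      | succ k =>
        -- Lower levels are padded up to the single level at which excluded middle is given.
        obtain ⟨φ', h', _, he⟩ := (h.mono (Nat.le_of_lt_succ hi)).exists_prenexClass (T := T)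
        refine Dec.congr (LEM.dec hT (b := false) (k := k) (fun χ hχ => ?_) h') he.symm
        exact hlower χ (.ax (.inr hχ))
    have hd := decPre_of_PNFT hT hupper hP hlem
    constructor
    · rintro _ ⟨φ, hφ, _, rfl⟩
      exact Proves.gen (.impI (dne_of_PNFT hT hupper hP le_rfl hd hφ))
    · rintro _ ⟨φ, hφ, _, rfl⟩
      exact Proves.gen (.impI (dns_of_PNFT hT hupper hP hd hφ))
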